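/- Let $V$ be the universe of all sets (satisfying ZFC), and assume the Singular Cardinals Hypothesis (SCH): for every singular cardinal $\lambda$ with $2^{\operatorname{cf}(\lambda)}<\lambda$, $\lambda^{\operatorname{cf}(\lambda)}=\lambda^{+}$. Let $M$ be a transitive class and let $j:V\to M$ be an elementary embedding (in the language $\{\in\}$) with critical point $\operatorname{crit}(j)$, the least ordinal $\alpha$ with $j(\alpha)\neq\alpha$. Let $\lambda$ be a singular cardinal of cofinality $\iota<\operatorname{crit}(j)$ and let $\delta=\lambda^{+}$. Then in $M$, the cofinality of $\sup j[\delta]=\sup\{j(\alpha):\alpha<\delta\}$ is the successor of a singular cardinal of cofinality $\iota$; that is, there is an ordinal $\eta$ such that $M$ satisfies "$\eta$ is a singular cardinal, $\operatorname{cf}(\eta)=\iota$, and $\operatorname{cf}(\sup j[\delta])=\eta^{+}$". -/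

import Mathlib

universe u

namespace SetEmb

open FirstOrder Ordinal

/-- The relation symbols of the first-order language of set theory: one binary symbol. -/
inductive MemRel : ℕ → Type
  | mem : MemRel 2

/-- The first-order language of set theory `{∈}`. -/
def memLang : FirstOrder.Language.{0, 0} := ⟨fun _ => Empty, MemRel⟩

/-- The universe `V` of all sets, as a structure for the language of set theory. -/
instance structureV : memLang.Structure ZFSet.{u} where
  funMap f := f.elim
  RelMap | .mem => fun x => x 0 ∈ x 1

/-- A class `M` of sets, with the true membership relation, as a structure for the language of
set theory. -/
instance structureClass (M : Set ZFSet.{u}) : memLang.Structure M where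
  funMap f := f.elim
  RelMap | .mem => fun x => (x 0 : ZFSet.{u}) ∈ (x 1 : ZFSet.{u})

/-- The Singular Cardinals Hypothesis: `λ ^ cf λ = λ⁺` for every singular cardinal `λ` with
`2 ^ cf λ < λ`. -/
def SCH : Prop :=
  ∀ c : Cardinal.{u}, c.IsSingular → (2 : Cardinal.{u}) ^ c.ord.cof < c →
    c ^ c.ord.cof = Order.succ c

/-- `κ` is the critical point of `j`: the least ordinal moved by `j`. -/
def IsCriticalPoint {M : Set ZFSet.{u}} (j : ZFSet.{u} ↪ₑ[memLang] M) (κ : Ordinal.{u}) : Prop :=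
  IsLeast {α : Ordinal.{u} | (j α.toZFSet : ZFSet.{u}) ≠ α.toZFSet} κ

/-- The ordinal `sup j[δ]`. For an ordinal `α`, `j α` is again a von Neumann ordinal, and the rank
of a von Neumann ordinal is that ordinal. -/
noncomputable def supImage {M : Set ZFSet.{u}} (j : ZFSet.{u} ↪ₑ[memLang] M) (δ : Ordinal.{u}) :
    Ordinal.{u} :=
  ⨆ α : Set.Iio δ, (j α.1.toZFSet : ZFSet.{u}).rank

/-! The notions below are the usual set-theoretic ones, relativized to a transitive class `M`
containing all ordinals: the functions they quantify over are required to be elements of `M`. -/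

/-- In `M`, there is a bijection from `α` onto `β`. -/
def EquinumerousIn (M : Set ZFSet.{u}) (α β : Ordinal.{u}) : Prop :=
  ∃ f ∈ M, ZFSet.IsFunc α.toZFSet β.toZFSet f ∧
    ∀ y ∈ β.toZFSet, ∃! x, ZFSet.pair x y ∈ f

/-- In `M`, the ordinal `η` is a cardinal: it is not equinumerous to a smaller ordinal. -/
def IsCardinalIn (M : Set ZFSet.{u}) (η : Ordinal.{u}) : Prop :=
  ∀ α < η, ¬ EquinumerousIn M α η

/-- In `M`, there is a function from `α` to `β` whose range is cofinal in `β`. -/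
def CofinalMapIn (M : Set ZFSet.{u}) (α β : Ordinal.{u}) : Prop :=
  ∃ f ∈ M, ZFSet.IsFunc α.toZFSet β.toZFSet f ∧
    ∀ γ < β, ∃ ξ < α, ∃ ζ < β, γ ≤ ζ ∧ ZFSet.pair ξ.toZFSet ζ.toZFSet ∈ f

/-- In `M`, the cofinality of `β` is `α`. -/
def IsCofIn (M : Set ZFSet.{u}) (β α : Ordinal.{u}) : Prop :=
  IsLeast {α : Ordinal.{u} | CofinalMapIn M α β} α

/-- In `M`, the ordinal `η` is a singular cardinal: an infinite cardinal whose cofinality is smaller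
than `η`. -/
def IsSingularCardinalIn (M : Set ZFSet.{u}) (η : Ordinal.{u}) : Prop :=
  IsCardinalIn M η ∧ ω ≤ η ∧ ∃ α < η, IsCofIn M η α

/-- In `M`, `θ` is the cardinal successor of `η`: the least cardinal greater than `η`. -/
def IsSuccCardinalIn (M : Set ZFSet.{u}) (η θ : Ordinal.{u}) : Prop :=
  IsLeast {θ : Ordinal.{u} | IsCardinalIn M θ ∧ η < θ} θ

end SetEmb

/-! ### Formulas of set theory and satisfaction in a class -/

namespace SetEmb

open FirstOrder Ordinal

/-! Write `σ = sup j[δ]`. The class `M` need not contain the restriction of `j` to `δ`, so the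
cofinality of `σ` in `M` is not computed directly. Instead, a first-order principle is proved in `V`
from SCH, transferred to `M` by elementarity, and applied there to `σ` (`clubPrinciple`,
`sat_clubPrinciple_univ`).

The principle rests on cardinal arithmetic (`eq_succ_of_eventually_different`). Let `ι` be regular,
`2 ^ ι < θ`, and suppose that a set `A` with `|A| < θ` carries at least `θ` functions `ι → A`, any
two agreeing on fewer than `ι` arguments. Let `ν` be least with `θ ≤ ν ^ ι`. Minimality gives `μ ^ ι
< ν` for all `μ < ν`, hence `cf ν ≤ ι < ν`, and SCH yields `ν ^ ι ≤ ν ^ cf ν = ν⁺`; so `θ = ν⁺`. If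
`cf ν < ι`, each function would be bounded below `ν` on `ι` many arguments, and its part below the
bound would determine it, leaving at most `ν` functions; so `cf ν = ι`. This is used with `θ = cf σ`
and `A` a proper initial segment of a club of `σ` all of whose proper initial segments have size
less than `cf σ`.

To apply the principle in `M`, let `C` be the club it provides for `σ`. Since `ω < crit(j)`, the map
`j` is continuous at suprema of `ω`-sequences, so `{α < δ : j(α) ∈ C}` is unbounded in `δ`
(`exists_mem_club`). Choose `λ` of its elements, bounded by some `ε < δ`, and `λ⁺` pairwise
eventually different functions from `ι` into them (`exists_eventually_different`). The image under
`j` of this family is eventually different in `M`, and its members with index `j(α)`, `α < δ`, take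
values in `C ∩ j(ε)`, because `j` fixes every ordinal up to `ι`.

The requirement `2 ^ ι < cf σ` in `M` follows from `2 ^ ι ≤ λ`, which holds if `crit(j) ≤ λ` because
`crit(j)` is closed under powers of two (`two_power_lt_crit`). If `λ < crit(j)`, then `δ < crit(j)`
and `σ = δ` is fixed by `j`. -/

/-- Formulas of the language of set theory, with de Bruijn variables. -/
inductive SetFormula
  | mem (i k : ℕ)
  | eq (i k : ℕ)
  | not (φ : SetFormula)
  | imp (φ ψ : SetFormula)
  | and (φ ψ : SetFormula)
  | or (φ ψ : SetFormula)
  | iff (φ ψ : SetFormula)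
  | all (φ : SetFormula)
  | ex (φ : SetFormula)

/-- Extend a valuation by a value for the variable `0`. -/
def cons {X : Type*} (x : X) (v : ℕ → X) : ℕ → X
  | 0 => x
  | n + 1 => v n

@[simp] theorem cons_zero {X : Type*} (x : X) (v : ℕ → X) : cons x v 0 = x := rfl

@[simp] theorem cons_succ {X : Type*} (x : X) (v : ℕ → X) (n : ℕ) : cons x v (n + 1) = v n := rfl

theorem comp_cons {X Y : Type*} (f : X → Y) (x : X) (v : ℕ → X) :
    (fun n => f (cons x v n)) = cons (f x) fun n => f (v n) := by
  funext n; cases n <;> rfl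

/-- Satisfaction of a formula in a class of sets. -/
@[simp] def Sat {N : Set ZFSet.{u}} : (ℕ → N) → SetFormula → Prop
  | v, .mem i k => (v i : ZFSet.{u}) ∈ (v k : ZFSet.{u})
  | v, .eq i k => (v i : ZFSet.{u}) = v k
  | v, .not φ => ¬ Sat v φ
  | v, .imp φ ψ => Sat v φ → Sat v ψ
  | v, .and φ ψ => Sat v φ ∧ Sat v ψ
  | v, .or φ ψ => Sat v φ ∨ Sat v ψ
  | v, .iff φ ψ => Sat v φ ↔ Sat v ψ
  | v, .all φ => ∀ x : N, Sat (cons x v) φ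
  | v, .ex φ => ∃ x : N, Sat (cons x v) φ

/-- A set as an element of the universal class. -/
def up (x : ZFSet.{u}) : (Set.univ : Set ZFSet.{u}) := ⟨x, trivial⟩

@[simp] theorem coe_up (x : ZFSet.{u}) : (up x : ZFSet.{u}) = x := rfl

theorem forall_univ_iff {p : ↥(Set.univ : Set ZFSet.{u}) → Prop} : (∀ x, p x) ↔ ∀ x, p (up x) :=
  ⟨fun h _ => h _, fun h x => h x.1⟩

theorem exists_univ_iff {p : ↥(Set.univ : Set ZFSet.{u}) → Prop} : (∃ x, p x) ↔ ∃ x, p (up x) :=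
  ⟨fun ⟨x, h⟩ => ⟨x.1, h⟩, fun ⟨_, h⟩ => ⟨_, h⟩⟩

/-! ### Translation into Mathlib's first-order formulas -/

section Translation

open FirstOrder.Language

/-- The membership symbol. -/
def memSymbol : memLang.Relations 2 := MemRel.mem

/-- Bind the free variable `0` of a first-order formula by a universal quantifier. -/
def allZero (φ : memLang.Formula ℕ) : memLang.Formula ℕ :=
  (BoundedFormula.relabel (n := 1) (k := 0)
    (fun i : ℕ => (i.casesOn (Sum.inr 0) Sum.inl : ℕ ⊕ Fin 1)) φ).all

theorem realize_allZero {X : Type*} [memLang.Structure X] (φ : memLang.Formula ℕ) (v : ℕ → X) :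
    (allZero φ).Realize v ↔ ∀ x, φ.Realize (cons x v) := by
  rw [allZero, Formula.Realize, BoundedFormula.realize_all]
  refine forall_congr' fun x => ?_
  rw [BoundedFormula.realize_relabel, Formula.Realize]
  have h : (Sum.elim v ((Fin.snoc default x : Fin 1 → X) ∘ Fin.castAdd 0) ∘
      fun i : ℕ => (i.casesOn (Sum.inr 0) Sum.inl : ℕ ⊕ Fin 1)) = cons x v := by
    funext n
    cases n with
    | zero => simp [Fin.snoc]
    | succ n => rfl
  rw [h, iff_eq_eq]
  exact congrArg _ (Subsingleton.elim _ _)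

/-- The point is that a single `ψ` serves both structures, so that elementarity for `ψ` becomes
elementarity for `φ`. -/
theorem exists_formula (M : Set ZFSet.{u}) (φ : SetFormula) : ∃ ψ : memLang.Formula ℕ,
    (∀ v : ℕ → ZFSet.{u}, ψ.Realize v ↔ Sat (fun n => up (v n)) φ) ∧
    ∀ v : ℕ → M, ψ.Realize v ↔ Sat v φ := by
  induction φ with
  | mem i k =>
    refine ⟨memSymbol.formula₂ (.var i) (.var k), fun v => ?_,
      fun v => ?_⟩ <;> rw [Formula.realize_rel₂] <;> exact Iff.rfl
  | eq i k =>
    refine ⟨Term.equal (.var i) (.var k), fun v => ?_, fun v => ?_⟩ <;>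
      rw [Formula.realize_equal]
    · exact Iff.rfl
    · exact Subtype.ext_iff
  | not φ ih =>
    obtain ⟨ψ, h, h'⟩ := ih
    exact ⟨ψ.not, fun v => by simp [h], fun v => by simp [h']⟩
  | imp φ φ' ih ih' =>
    obtain ⟨ψ, h, h'⟩ := ih
    obtain ⟨χ, g, g'⟩ := ih'
    exact ⟨ψ.imp χ, fun v => by simp [h, g], fun v => by simp [h', g']⟩
  | and φ φ' ih ih' =>
    obtain ⟨ψ, h, h'⟩ := ih
    obtain ⟨χ, g, g'⟩ := ih'
    exact ⟨ψ ⊓ χ, fun v => by simp [h, g], fun v => by simp [h', g']⟩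
  | or φ φ' ih ih' =>
    obtain ⟨ψ, h, h'⟩ := ih
    obtain ⟨χ, g, g'⟩ := ih'
    exact ⟨ψ ⊔ χ, fun v => by simp [h, g], fun v => by simp [h', g']⟩
  | iff φ φ' ih ih' =>
    obtain ⟨ψ, h, h'⟩ := ih
    obtain ⟨χ, g, g'⟩ := ih'
    exact ⟨ψ.iff χ, fun v => by simp [h, g], fun v => by simp [h', g']⟩
  | all φ ih =>
    obtain ⟨ψ, h, h'⟩ := ih
    refine ⟨allZero ψ, fun v => ?_, fun v => ?_⟩ <;> rw [realize_allZero]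
    · simp only [h, comp_cons, Sat, forall_univ_iff]
    · simp only [h', Sat]
  | ex φ ih =>
    obtain ⟨ψ, h, h'⟩ := ih
    refine ⟨(allZero ψ.not).not, fun v => ?_, fun v => ?_⟩ <;>
      rw [Formula.realize_not, realize_allZero]
    · simp only [Formula.realize_not, h, comp_cons, Sat, exists_univ_iff, not_forall, not_not]
    · simp [h']

end Translation

/-- Elementarity of an embedding. -/
theorem sat_map {M : Set ZFSet.{u}} (j : ZFSet.{u} ↪ₑ[memLang] M) (v : ℕ → ZFSet.{u})
    (φ : SetFormula) : Sat (fun n => j (v n)) φ ↔ Sat (fun n => up (v n)) φ := by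
  obtain ⟨ψ, h, h'⟩ := exists_formula M φ
  rw [← h, ← h']
  exact j.map_formula ψ v

/-! ### Transitive classes closed under pairs -/

/-- A transitive class closed under unordered pairs. -/
structure IsPairingClass (N : Set ZFSet.{u}) : Prop where
  trans : ∀ x ∈ N, ∀ y ∈ x, y ∈ N
  pair : ∀ x ∈ N, ∀ y ∈ N, ({x, y} : ZFSet.{u}) ∈ N

theorem isPairingClass_univ : IsPairingClass (Set.univ : Set ZFSet.{u}) :=
  ⟨fun _ _ _ _ => trivial, fun _ _ _ _ => trivial⟩

/-- The pairing axiom passes from `V` to `M` by elementarity, and transitivity makes the pair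
computed in `M` the true one. -/
theorem IsPairingClass.of_embedding {M : Set ZFSet.{u}} (hM : ∀ x ∈ M, ∀ y ∈ x, y ∈ M)
    (j : ZFSet.{u} ↪ₑ[memLang] M) : IsPairingClass M := by
  refine ⟨hM, fun x hx y hy => ?_⟩
  have h := (sat_map j (fun _ => ∅) (.all (.all (.ex (.all
    (.iff (.mem 0 1) (.or (.eq 0 3) (.eq 0 2)))))))).2 (by
      intro x y
      exact ⟨up {x.1, y.1}, fun w => by simp [cons]⟩)
  obtain ⟨z, hz⟩ := h ⟨x, hx⟩ ⟨y, hy⟩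
  have : (z : ZFSet.{u}) = {x, y} := by
    ext w
    rw [ZFSet.mem_pair]
    constructor
    · exact fun hw => (hz ⟨w, hM _ z.2 _ hw⟩).1 hw
    · rintro (rfl | rfl)
      · exact (hz ⟨_, hx⟩).2 (Or.inl rfl)
      · exact (hz ⟨_, hy⟩).2 (Or.inr rfl)
  exact this ▸ z.2

namespace IsPairingClass

variable {N : Set ZFSet.{u}} (hN : IsPairingClass N)
include hN

theorem eq_iff {z : ZFSet.{u}} (hz : z ∈ N) {w : ZFSet.{u}} (hw : ∀ x ∈ w, x ∈ N) :
    (∀ x : N, (x : ZFSet.{u}) ∈ z ↔ (x : ZFSet.{u}) ∈ w) ↔ z = w := by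
  refine ⟨fun h => ZFSet.ext fun x => ⟨fun hx => ?_, fun hx => ?_⟩, fun h x => by rw [h]⟩
  · exact (h ⟨x, hN.trans _ hz _ hx⟩).1 hx
  · exact (h ⟨x, hw _ hx⟩).2 hx

theorem singleton {x : ZFSet.{u}} (hx : x ∈ N) : ({x} : ZFSet.{u}) ∈ N := by
  rw [← ZFSet.pair_eq_singleton]
  exact hN.pair x hx x hx

theorem ordered_pair {x y : ZFSet.{u}} (hx : x ∈ N) (hy : y ∈ N) : ZFSet.pair x y ∈ N :=
  hN.pair _ (hN.singleton hx) _ (hN.pair _ hx _ hy)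

theorem fst_mem {x y : ZFSet.{u}} (h : ZFSet.pair x y ∈ N) : x ∈ N :=
  hN.trans _ (hN.trans _ h {x} (by simp [ZFSet.pair])) x (by simp)

theorem snd_mem {x y : ZFSet.{u}} (h : ZFSet.pair x y ∈ N) : y ∈ N :=
  hN.trans _ (hN.trans _ h {x, y} (by simp [ZFSet.pair])) y (by simp)

theorem forall_mem_iff (a : N) {p : ZFSet.{u} → Prop} :
    (∀ x : N, (x : ZFSet.{u}) ∈ (a : ZFSet.{u}) → p x) ↔ ∀ x ∈ (a : ZFSet.{u}), p x :=
  ⟨fun h x hx => h ⟨x, hN.trans _ a.2 _ hx⟩ hx, fun h x hx => h x hx⟩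

theorem exists_mem_iff (a : N) {p : ZFSet.{u} → Prop} :
    (∃ x : N, (x : ZFSet.{u}) ∈ (a : ZFSet.{u}) ∧ p x) ↔ ∃ x ∈ (a : ZFSet.{u}), p x :=
  ⟨fun ⟨x, hx, h⟩ => ⟨x, hx, h⟩, fun ⟨x, hx, h⟩ => ⟨⟨x, hN.trans _ a.2 _ hx⟩, hx, h⟩⟩

end IsPairingClass

/-! ### Formulas for functions, cardinals and cofinality -/

namespace SetFormula

/-- `p = (x, y)`. -/
def isPair (p x y : ℕ) : SetFormula :=
  .all (.iff (.mem 0 (p + 1)) (.or (.all (.iff (.mem 0 1) (.eq 0 (x + 2))))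
    (.all (.iff (.mem 0 1) (.or (.eq 0 (x + 2)) (.eq 0 (y + 2)))))))

/-- `(x, y) ∈ f`. -/
def pairMem (x y f : ℕ) : SetFormula := .ex (.and (isPair 0 (x + 1) (y + 1)) (.mem 0 (f + 1)))

/-- `((x, y), z) ∈ f`. -/
def tripleMem (x y z f : ℕ) : SetFormula :=
  .ex (.and (isPair 0 (x + 1) (y + 1)) (pairMem 0 (z + 1) (f + 1)))

/-- `f` is a function from `x` to `y`. -/
def isFunc (x y f : ℕ) : SetFormula :=
  .and (.all (.imp (.mem 0 (f + 1)) (.ex (.and (.mem 0 (x + 2)) (.ex (.and (.mem 0 (y + 3))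
      (isPair 2 1 0)))))))
    (.all (.imp (.mem 0 (x + 1)) (.ex (.and (pairMem 1 0 (f + 2))
      (.all (.imp (pairMem 2 0 (f + 3)) (.eq 0 1)))))))

/-- `x` is transitive. -/
def isTransitive (x : ℕ) : SetFormula :=
  .all (.imp (.mem 0 (x + 1)) (.all (.imp (.mem 0 1) (.mem 0 (x + 2)))))

/-- `x` is an ordinal. -/
def isOrdinal (x : ℕ) : SetFormula :=
  .and (isTransitive x) (.all (.imp (.mem 0 (x + 1)) (isTransitive 0)))

/-- The ordinals `a` and `b` are equinumerous. -/
def equinumerous (a b : ℕ) : SetFormula :=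
  .ex (.and (isFunc (a + 1) (b + 1) 0) (.all (.imp (.mem 0 (b + 2)) (.ex (.and (pairMem 0 1 2)
    (.all (.imp (pairMem 0 2 3) (.eq 0 1))))))))

/-- The ordinal `a` is a cardinal. -/
def isCardinal (a : ℕ) : SetFormula := .all (.imp (.mem 0 (a + 1)) (.not (equinumerous 0 (a + 1))))

/-- There is a cofinal map from the ordinal `a` to the ordinal `b`. -/
def cofinalMap (a b : ℕ) : SetFormula :=
  .ex (.and (isFunc (a + 1) (b + 1) 0) (.all (.imp (.mem 0 (b + 2)) (.ex (.and (.mem 0 (a + 3))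
    (.ex (.and (.mem 0 (b + 4)) (.and (.or (.eq 2 0) (.mem 2 0)) (pairMem 1 0 3)))))))))

/-- The cofinality of the ordinal `b` is `a`. -/
def isCof (b a : ℕ) : SetFormula :=
  .and (cofinalMap a b) (.all (.imp (.mem 0 (a + 1)) (.not (cofinalMap 0 (b + 1)))))

/-- The ordinal `b` is the cardinal successor of the ordinal `a`. -/
def isSuccCardinal (a b : ℕ) : SetFormula :=
  .and (.and (isCardinal b) (.mem a b))
    (.all (.imp (.mem 0 (b + 1)) (.not (.and (isCardinal 0) (.mem (a + 1) 0)))))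

/-- The cofinality of `s` is the successor of a cardinal greater than `i` and of cofinality `i`. -/
def cofIsSucc (s i : ℕ) : SetFormula :=
  .ex (.and (.or (.eq 0 (s + 1)) (.mem 0 (s + 1))) (.and (isCof (s + 1) 0) (.ex (.and (.mem 0 1)
    (.and (isSuccCardinal 0 1) (.and (isCardinal 0) (.and (.mem (i + 2) 0) (isCof 0 (i + 2)))))))))

end SetFormula

/-! ### Absoluteness of pairs, functions and ordinals -/

section Interpretation

variable {N : Set ZFSet.{u}} (hN : IsPairingClass N) (v : ℕ → N)
include hN

open ZFSet SetFormula

theorem sat_isPair (p x y : ℕ) :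
    Sat v (.isPair p x y) ↔ (v p : ZFSet.{u}) = pair (v x) (v y) := by
  have h1 (z : N) : (∀ w : N, (w : ZFSet.{u}) ∈ (z : ZFSet.{u}) ↔ (w : ZFSet.{u}) = v x) ↔
      (z : ZFSet.{u}) = {(v x : ZFSet.{u})} := by
    rw [← hN.eq_iff z.2 (by simp)]
    simp
  have h2 (z : N) : (∀ w : N, (w : ZFSet.{u}) ∈ (z : ZFSet.{u}) ↔
      (w : ZFSet.{u}) = v x ∨ (w : ZFSet.{u}) = v y) ↔
      (z : ZFSet.{u}) = {(v x : ZFSet.{u}), (v y : ZFSet.{u})} := by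
    rw [← hN.eq_iff z.2 (by simp)]
    simp
  have h3 := hN.eq_iff (v p).2 (w := pair (v x) (v y)) (by
    simp only [pair, mem_pair]
    rintro _ (rfl | rfl)
    exacts [hN.singleton (v x).2, hN.pair _ (v x).2 _ (v y).2])
  rw [← h3]
  simp only [isPair, Sat, cons_zero, cons_succ, pair, mem_pair, ← h1, ← h2]

theorem sat_pairMem (x y f : ℕ) :
    Sat v (.pairMem x y f) ↔ pair (v x) (v y) ∈ (v f : ZFSet.{u}) := by
  simp only [pairMem, Sat, sat_isPair hN, cons_zero, cons_succ]
  exact ⟨fun ⟨z, h, h'⟩ => h ▸ h', fun h => ⟨⟨_, hN.ordered_pair (v x).2 (v y).2⟩, rfl, h⟩⟩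

theorem sat_tripleMem (x y z f : ℕ) :
    Sat v (.tripleMem x y z f) ↔ pair (pair (v x) (v y)) (v z) ∈ (v f : ZFSet.{u}) := by
  simp only [tripleMem, Sat, sat_isPair hN, sat_pairMem hN, cons_zero, cons_succ]
  exact ⟨fun ⟨z, h, h'⟩ => h ▸ h', fun h => ⟨⟨_, hN.ordered_pair (v x).2 (v y).2⟩, rfl, h⟩⟩

theorem sat_isFunc (x y f : ℕ) : Sat v (.isFunc x y f) ↔ IsFunc (v x) (v y) (v f) := by
  simp only [isFunc, Sat, sat_isPair hN, sat_pairMem hN]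
  refine and_congr ?_ ?_
  · refine (hN.forall_mem_iff (v f) (p := fun p => ∃ a : N, (a : ZFSet.{u}) ∈ (v x : ZFSet.{u}) ∧
      ∃ b : N, (b : ZFSet.{u}) ∈ (v y : ZFSet.{u}) ∧ p = pair a b)).trans ?_
    refine forall₂_congr fun p hp => ?_
    rw [mem_prod, hN.exists_mem_iff (v x) (p := fun a => ∃ b : N,
      (b : ZFSet.{u}) ∈ (v y : ZFSet.{u}) ∧ p = pair a b)]
    exact exists_congr fun a => and_congr_right fun _ =>
      hN.exists_mem_iff (v y) (p := fun b => p = pair a b)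
  · refine (hN.forall_mem_iff (v x) (p := fun a => ∃ b : N, pair a b ∈ (v f : ZFSet.{u}) ∧
      ∀ c : N, pair a c ∈ (v f : ZFSet.{u}) → (c : ZFSet.{u}) = b)).trans ?_
    refine forall₂_congr fun a ha => ?_
    constructor
    · rintro ⟨b, hb, hc⟩
      exact ⟨b, hb, fun c h => hc ⟨c, hN.snd_mem (hN.trans _ (v f).2 _ h)⟩ h⟩
    · rintro ⟨b, hb, hc⟩
      exact ⟨⟨b, hN.snd_mem (hN.trans _ (v f).2 _ hb)⟩, hb, fun c h => hc c h⟩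

theorem sat_isTransitive (x : ℕ) : Sat v (.isTransitive x) ↔ (v x : ZFSet.{u}).IsTransitive := by
  simp only [isTransitive, Sat]
  refine (hN.forall_mem_iff (v x) (p := fun a => ∀ b : N, (b : ZFSet.{u}) ∈ a →
    (b : ZFSet.{u}) ∈ (v x : ZFSet.{u}))).trans (forall₂_congr fun a ha => ?_)
  exact hN.forall_mem_iff ⟨a, hN.trans _ (v x).2 _ ha⟩

theorem sat_isOrdinal (x : ℕ) : Sat v (.isOrdinal x) ↔ (v x : ZFSet.{u}).IsOrdinal := by
  rw [isOrdinal_iff_forall_mem_isTransitive]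
  simp only [isOrdinal, Sat, sat_isTransitive hN]
  exact and_congr_right fun _ => hN.forall_mem_iff (v x)

end Interpretation

/-! ### Meaning of the cardinal and cofinality formulas in a class -/

section Ordinals

theorem isLeast_iff_forall_lt {S : Set Ordinal.{u}} {α : Ordinal.{u}} :
    IsLeast S α ↔ α ∈ S ∧ ∀ β < α, β ∉ S :=
  and_congr_right fun _ => forall_congr' fun _ =>
    ⟨fun h hβ hS => (h hS).not_gt hβ, fun h hS => not_lt.1 fun hβ => h hβ hS⟩

variable {N : Set ZFSet.{u}} (hN : IsPairingClass N) {v : ℕ → N}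

open ZFSet SetFormula

theorem forall_lt_iff {α : Ordinal.{u}} (a : N) (ha : (a : ZFSet.{u}) = α.toZFSet)
    {p : N → Prop} : (∀ x : N, (x : ZFSet.{u}) ∈ (a : ZFSet.{u}) → p x) ↔
      ∀ β < α, ∀ x : N, (x : ZFSet.{u}) = β.toZFSet → p x := by
  simp only [ha, mem_toZFSet_iff]
  exact ⟨fun h β hβ x hx => h x ⟨β, hβ, hx.symm⟩, fun h x ⟨β, hβ, hx⟩ => h β hβ x hx.symm⟩

include hN

theorem toZFSet_mem_of_lt {α β : Ordinal.{u}} (h : α < β) (a : N)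
    (ha : (a : ZFSet.{u}) = β.toZFSet) : α.toZFSet ∈ N :=
  hN.trans _ a.2 _ (by rw [ha]; exact toZFSet_mem_toZFSet_iff.2 h)

theorem sat_equinumerous (a b : ℕ) {α β : Ordinal.{u}} (ha : (v a : ZFSet.{u}) = α.toZFSet)
    (hb : (v b : ZFSet.{u}) = β.toZFSet) : Sat v (.equinumerous a b) ↔ EquinumerousIn N α β := by
  simp only [equinumerous, Sat, sat_isFunc hN, sat_pairMem hN, EquinumerousIn, cons_zero,
    cons_succ, ha, hb]
  constructor
  · rintro ⟨f, hf, h⟩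
    refine ⟨f, f.2, hf, fun y hy => ?_⟩
    obtain ⟨x, hx, hx'⟩ := h ⟨y, hN.trans _ (v b).2 _ (hb ▸ hy)⟩ hy
    exact ⟨x, hx, fun x' h' => hx' ⟨x', hN.fst_mem (hN.trans _ f.2 _ h')⟩ h'⟩
  · rintro ⟨f, hfN, hf, h⟩
    refine ⟨⟨f, hfN⟩, hf, fun y hy => ?_⟩
    obtain ⟨x, hx, hx'⟩ := h y hy
    exact ⟨⟨x, hN.fst_mem (hN.trans _ hfN _ hx)⟩, hx, fun x' h' => hx' x' h'⟩

theorem sat_isCardinal (a : ℕ) {α : Ordinal.{u}} (ha : (v a : ZFSet.{u}) = α.toZFSet) :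
    Sat v (.isCardinal a) ↔ IsCardinalIn N α := by
  simp only [isCardinal, Sat]
  refine (forall_lt_iff (v a) ha (p := fun x => ¬ Sat (cons x v) (.equinumerous 0 (a + 1)))).trans
    (forall₂_congr fun β hβ => ?_)
  constructor
  · exact fun h h' => h ⟨_, toZFSet_mem_of_lt hN hβ _ ha⟩ rfl
      ((sat_equinumerous hN 0 (a + 1) (by rfl) ha).2 h')
  · exact fun h x hx h' => h ((sat_equinumerous hN 0 (a + 1) hx ha).1 h')

theorem sat_cofinalMap (a b : ℕ) {α β : Ordinal.{u}} (ha : (v a : ZFSet.{u}) = α.toZFSet)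
    (hb : (v b : ZFSet.{u}) = β.toZFSet) : Sat v (.cofinalMap a b) ↔ CofinalMapIn N α β := by
  simp only [cofinalMap, Sat, sat_isFunc hN, sat_pairMem hN, CofinalMapIn, cons_zero,
    cons_succ, ha, hb]
  constructor
  · rintro ⟨f, hf, h⟩
    refine ⟨f, f.2, hf, fun γ hγ => ?_⟩
    obtain ⟨x, hx, z, hz, h1, h2⟩ := h ⟨_, toZFSet_mem_of_lt hN hγ _ hb⟩
      (toZFSet_mem_toZFSet_iff.2 hγ)
    obtain ⟨ξ, hξ, hξ'⟩ := mem_toZFSet_iff.1 hx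
    obtain ⟨ζ, hζ, hζ'⟩ := mem_toZFSet_iff.1 hz
    refine ⟨ξ, hξ, ζ, hζ, ?_, ?_⟩
    · rcases h1 with h1 | h1
      · have : γ.toZFSet = ζ.toZFSet := h1.trans hζ'.symm
        exact (toZFSet_injective this).le
      · have : γ.toZFSet ∈ ζ.toZFSet := hζ' ▸ h1
        exact (toZFSet_mem_toZFSet_iff.1 this).le
    · rw [hξ', hζ']
      exact h2
  · rintro ⟨f, hfN, hf, h⟩
    refine ⟨⟨f, hfN⟩, hf, fun y hy => ?_⟩
    obtain ⟨γ, hγ, hγ'⟩ := mem_toZFSet_iff.1 hy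
    obtain ⟨ξ, hξ, ζ, hζ, h1, h2⟩ := h γ hγ
    refine ⟨⟨_, toZFSet_mem_of_lt hN hξ _ ha⟩, toZFSet_mem_toZFSet_iff.2 hξ,
      ⟨_, toZFSet_mem_of_lt hN hζ _ hb⟩, toZFSet_mem_toZFSet_iff.2 hζ, ?_, h2⟩
    change (y : ZFSet.{u}) = ζ.toZFSet ∨ (y : ZFSet.{u}) ∈ ζ.toZFSet
    rw [← hγ', toZFSet_mem_toZFSet_iff, toZFSet_injective.eq_iff]
    exact h1.eq_or_lt

theorem sat_isCof (a b : ℕ) {α β : Ordinal.{u}} (ha : (v a : ZFSet.{u}) = α.toZFSet)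
    (hb : (v b : ZFSet.{u}) = β.toZFSet) : Sat v (.isCof b a) ↔ IsCofIn N β α := by
  rw [IsCofIn, isLeast_iff_forall_lt]
  simp only [isCof, Sat, Set.mem_ofPred_eq, sat_cofinalMap hN a b ha hb]
  refine and_congr_right fun _ => (forall_lt_iff (v a) ha
    (p := fun x => ¬ Sat (cons x v) (.cofinalMap 0 (b + 1)))).trans
    (forall₂_congr fun γ hγ => ?_)
  constructor
  · exact fun h h' => h ⟨_, toZFSet_mem_of_lt hN hγ _ ha⟩ rfl
      ((sat_cofinalMap hN 0 (b + 1) (by rfl) hb).2 h')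
  · exact fun h x hx h' => h ((sat_cofinalMap hN 0 (b + 1) hx hb).1 h')

theorem sat_isSuccCardinal (a b : ℕ) {α β : Ordinal.{u}} (ha : (v a : ZFSet.{u}) = α.toZFSet)
    (hb : (v b : ZFSet.{u}) = β.toZFSet) :
    Sat v (.isSuccCardinal a b) ↔ IsSuccCardinalIn N α β := by
  rw [IsSuccCardinalIn, isLeast_iff_forall_lt]
  simp only [isSuccCardinal, Sat, Set.mem_ofPred_eq, sat_isCardinal hN b hb]
  refine and_congr ?_ ((forall_lt_iff (v b) hb
    (p := fun x => ¬ (Sat (cons x v) (.isCardinal 0) ∧ (v a : ZFSet.{u}) ∈ (x : ZFSet.{u})))).trans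
    (forall₂_congr fun γ hγ => ?_))
  · rw [ha, hb, toZFSet_mem_toZFSet_iff]
  · constructor
    · exact fun h h' => h ⟨_, toZFSet_mem_of_lt hN hγ _ hb⟩ rfl
        ⟨(sat_isCardinal hN 0 (by rfl)).2 h'.1, by
          rw [ha]; exact toZFSet_mem_toZFSet_iff.2 h'.2⟩
    · intro h x hx h'
      refine h ⟨(sat_isCardinal hN 0 hx).1 h'.1, ?_⟩
      have := h'.2
      rwa [ha, hx, toZFSet_mem_toZFSet_iff] at this

/-- In `N`, the cofinality of `σ` is the successor of a cardinal above `i`, of cofinality `i`. -/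
def CofIsSuccIn (N : Set ZFSet.{u}) (σ i : Ordinal.{u}) : Prop :=
  ∃ θ ≤ σ, IsCofIn N σ θ ∧ ∃ η < θ, IsSuccCardinalIn N η θ ∧ IsCardinalIn N η ∧ i < η ∧ IsCofIn N η i

/-- The bounds `θ ≤ σ` and `η < θ` force both witnesses to be ordinals lying in `N`, so the formula
need not say so. -/
theorem sat_cofIsSucc (s i : ℕ) {σ ι : Ordinal.{u}} (hs : (v s : ZFSet.{u}) = σ.toZFSet)
    (hi : (v i : ZFSet.{u}) = ι.toZFSet) :
    Sat v (.cofIsSucc s i) ↔ CofIsSuccIn N σ ι := by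
  simp only [cofIsSucc, Sat, CofIsSuccIn]
  constructor
  · rintro ⟨t, ht, h1, e, he, h2, h3, h4, h5⟩
    obtain ⟨θ, hθ, hθ'⟩ : ∃ θ ≤ σ, (t : ZFSet.{u}) = θ.toZFSet := by
      rcases ht with ht | ht
      · exact ⟨σ, le_rfl, ht.trans hs⟩
      · obtain ⟨θ, hθ, h⟩ := mem_toZFSet_iff.1 (hs ▸ (show (t : ZFSet.{u}) ∈ (v s : ZFSet.{u}) from ht))
        exact ⟨θ, hθ.le, h.symm⟩
    obtain ⟨η, hη, hη'⟩ := mem_toZFSet_iff.1 (hθ' ▸ (show (e : ZFSet.{u}) ∈ (t : ZFSet.{u}) from he))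
    refine ⟨θ, hθ, (sat_isCof hN (v := cons t v) 0 (s + 1) hθ' hs).1 h1, η, hη,
      (sat_isSuccCardinal hN (v := cons e (cons t v)) 0 1 hη'.symm hθ').1 h2,
      (sat_isCardinal hN (v := cons e (cons t v)) 0 hη'.symm).1 h3, ?_,
      (sat_isCof hN (v := cons e (cons t v)) (i + 2) 0 hi hη'.symm).1 h5⟩
    have h4 : (v i : ZFSet.{u}) ∈ (e : ZFSet.{u}) := h4
    rwa [hi, ← hη', toZFSet_mem_toZFSet_iff] at h4
  · rintro ⟨θ, hθ, h1, η, hη, h2, h3, h4, h5⟩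
    have hθN : θ.toZFSet ∈ N := by
      rcases hθ.eq_or_lt with rfl | h
      · exact hs ▸ (v s).2
      · exact toZFSet_mem_of_lt hN h _ hs
    let t : N := ⟨_, hθN⟩
    let e : N := ⟨η.toZFSet, toZFSet_mem_of_lt hN hη t rfl⟩
    refine ⟨t, ?_, (sat_isCof hN (v := cons t v) 0 (s + 1) rfl hs).2 h1, e, toZFSet_mem_toZFSet_iff.2 hη,
      (sat_isSuccCardinal hN (v := cons e (cons t v)) 0 1 (α := η) (β := θ) rfl rfl).2 h2,
      (sat_isCardinal hN (v := cons e (cons t v)) 0 (α := η) rfl).2 h3, ?_,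
      (sat_isCof hN (v := cons e (cons t v)) (i + 2) 0 (β := η) hi rfl).2 h5⟩
    · change θ.toZFSet = (v s : ZFSet.{u}) ∨ θ.toZFSet ∈ (v s : ZFSet.{u})
      rw [hs, toZFSet_mem_toZFSet_iff, toZFSet_injective.eq_iff]
      exact hθ.eq_or_lt
    · change (v i : ZFSet.{u}) ∈ η.toZFSet
      rw [hi]
      exact toZFSet_mem_toZFSet_iff.2 h4

end Ordinals

/-! ### Cardinal arithmetic under SCH -/

section Cardinals

open Cardinal Order

/-- The part of a function that lies below a bound. -/
def truncate {I W : Type u} [LinearOrder W] (c : W) (h : I → W) (i : I) : Option (Set.Iio c) :=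
  if hi : h i < c then some ⟨h i, hi⟩ else none

theorem eq_of_truncate_eq {I W : Type u} [LinearOrder W] {c : W} {h h' : I → W}
    (H : truncate c h = truncate c h') {i : I} (hi : h i < c) : h i = h' i := by
  have := congrFun H i
  unfold truncate at this
  rw [dif_pos hi] at this
  split_ifs at this with h1
  exact congrArg Subtype.val (Option.some.inj this)

variable {I : Type u} {ν : Cardinal.{u}}

theorem mk_truncations_lt (hI : ∀ μ < ν, μ ^ #I < ν) (hν : ℵ₀ ≤ ν) (c : ν.ord.ToType) :
    #(I → Option (Set.Iio c)) < ν := by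
  rw [mk_arrow, Cardinal.lift_id, Cardinal.lift_id]
  refine hI _ ?_
  rw [mk_option]
  refine add_lt_of_lt hν ?_ (one_lt_aleph0.trans_le hν)
  simpa using mk_Iio_lt c (by simp)

/-- Were the cofinality larger than `#I`, every function `I → ν` would be bounded, hence coded by a
bound and a truncation; there are only `ν · ν = ν` such codes. -/
theorem cof_le_of_lt_power (hI : ∀ μ < ν, μ ^ #I < ν) (hν : ℵ₀ ≤ ν) (h : ν < ν ^ #I) :
    ν.ord.cof ≤ #I := by
  by_contra! hcof
  have hb (f : I → ν.ord.ToType) : ∃ c, ∀ i, f i < c := by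
    have : ¬ IsCofinal (Set.range f) := fun hf => by
      have := (cof_le hf).trans mk_range_le
      rw [cof_toType] at this
      exact this.not_gt hcof
    rw [not_isCofinal_iff] at this
    exact this.imp fun c hc i => hc _ ⟨i, rfl⟩
  choose b hb using hb
  have hinj : Function.Injective fun f : I → ν.ord.ToType =>
      (⟨b f, truncate (b f) f⟩ : Σ c, I → Option (Set.Iio c)) := by
    intro f f' hff
    obtain ⟨h1, h2⟩ := Sigma.mk.inj_iff.1 hff
    rw [h1, heq_iff_eq] at h2
    funext i
    exact eq_of_truncate_eq h2 (h1 ▸ hb f i)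
  have := mk_le_of_injective hinj
  rw [mk_arrow, Cardinal.lift_id, Cardinal.lift_id, mk_sigma, mk_toType, card_ord] at this
  refine (this.trans (sum_le_sum _ (fun _ => ν) fun c =>
    (mk_truncations_lt hI hν c).le)).not_gt ?_
  simpa [mul_eq_self hν] using h

/-- A function into `ν` is determined by its truncations along a cofinal set of size `cf ν`, and
each truncation has fewer than `ν` possible values. -/
theorem power_le_power_cof (hI : ∀ μ < ν, μ ^ #I < ν) (hν : ℵ₀ ≤ ν) :
    ν ^ #I ≤ ν ^ ν.ord.cof := by
  obtain ⟨C, hC, hC'⟩ := Order.exists_cof_eq ν.ord.ToType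
  have : NoMaxOrder ν.ord.ToType := Cardinal.noMaxOrder hν
  have hinj : Function.Injective fun (f : I → ν.ord.ToType) (c : C) => truncate c.1 f := by
    intro f f' hff
    funext i
    obtain ⟨d, hd⟩ := exists_gt (f i)
    obtain ⟨c, hc, hcd⟩ := hC d
    exact eq_of_truncate_eq (congrFun hff ⟨c, hc⟩) (hd.trans_le hcd)
  have := mk_le_of_injective hinj
  rw [mk_arrow, Cardinal.lift_id, Cardinal.lift_id, mk_pi, mk_toType, card_ord] at this
  refine (this.trans (prod_le_prod _ (fun _ => ν) fun c =>
    (mk_truncations_lt hI hν c.1).le)).trans ?_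
  simp [hC']

/-- If `cf ν < #I`, regularity of `#I` gives each `g b` a bound from a fixed cofinal set that works
on `#I` many arguments. Two functions with the same bound and truncation agree on all of these
arguments, so `b` is determined by one of `cf ν · ν ≤ ν` codes. -/
theorem le_cof_of_eventually_different (hI : ∀ μ < ν, μ ^ #I < ν) (hν : ℵ₀ ≤ ν)
    (hreg : (#I).IsRegular) (hsing : ν.ord.cof ≤ ν) {B : Type u} (hB : ν < #B)
    (g : B → I → ν.ord.ToType) (hg : ∀ b b', b ≠ b' → #{i | g b i = g b' i} < #I) :
    #I ≤ ν.ord.cof := by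
  by_contra! hcof
  obtain ⟨C, hC, hC'⟩ := Order.exists_cof_eq ν.ord.ToType
  have : NoMaxOrder ν.ord.ToType := Cardinal.noMaxOrder hν
  have hb (b : B) : ∃ c : C, #I ≤ #{i | g b i < c} := by
    by_contra! h
    have h1 : #C < #I := by rwa [hC', cof_toType]
    refine ((card_iUnion_lt_iff_forall_of_isRegular hreg h1).2 h).ne ?_
    rw [← mk_univ (α := I)]
    suffices h : (⋃ c : C, {i | g b i < c.1}) = Set.univ by rw [h]
    refine Set.eq_univ_of_forall fun i => ?_
    obtain ⟨d, hd⟩ := exists_gt (g b i)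
    obtain ⟨c, hc, hcd⟩ := hC d
    exact Set.mem_iUnion.2 ⟨⟨c, hc⟩, hd.trans_le hcd⟩
  choose c hc using hb
  have hinj : Function.Injective fun b : B =>
      (⟨c b, truncate (c b).1 (g b)⟩ : Σ c : C, I → Option (Set.Iio c.1)) := by
    intro b b' hbb
    by_contra hne
    obtain ⟨h1, h2⟩ := Sigma.mk.inj_iff.1 hbb
    rw [h1, heq_iff_eq] at h2
    refine (hg b b' hne).not_ge ((hc b).trans (mk_le_mk_of_subset fun i hi => ?_))
    exact eq_of_truncate_eq h2 (h1 ▸ hi)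
  have := mk_le_of_injective hinj
  rw [mk_sigma] at this
  refine (this.trans (sum_le_sum _ (fun _ => ν) fun c =>
    (mk_truncations_lt hI hν c.1).le)).not_gt ?_
  rw [sum_const, Cardinal.lift_id, Cardinal.lift_id, hC', cof_toType]
  exact (mul_le_of_le hν hsing le_rfl).trans_lt hB

theorem eq_succ_of_eventually_different (hSCH : SCH.{u}) (hreg : (#I).IsRegular)
    {A B : Type u} {θ : Cardinal.{u}} (hA : #A < θ) (hB : θ ≤ #B) (h2 : 2 ^ #I < θ)
    (g : B → I → A) (hg : ∀ b b', b ≠ b' → #{i | g b i = g b' i} < #I) :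
    ∃ ν : Cardinal.{u}, θ = succ ν ∧ ν.IsSingular ∧ ν.ord.cof = #I := by
  have hg' : Function.Injective g := by
    intro b b' h
    by_contra hne
    have := hg b b' hne
    simp [h] at this
  have hAθ : θ ≤ #A ^ #I := by
    refine hB.trans ((mk_le_of_injective hg').trans_eq ?_)
    simp
  let S : Set Cardinal.{u} := {ν | θ ≤ ν ^ #I}
  let ν := sInf S
  have hνS : θ ≤ ν ^ #I := csInf_mem (s := S) ⟨_, hAθ⟩
  have hνA : ν ≤ #A := csInf_le' hAθ
  have hmin (μ : Cardinal.{u}) (hμ : μ < ν) : μ ^ #I < ν := by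
    by_contra! h
    -- `ν ≤ μ ^ #I` gives `ν ^ #I ≤ (μ ^ #I) ^ #I = μ ^ #I`, against the minimality of `ν`.
    have h1 : θ ≤ μ ^ #I := by
      refine hνS.trans ((power_le_power_right h).trans_eq ?_)
      rw [← power_mul, mul_eq_self hreg.aleph0_le]
    exact hμ.not_ge (csInf_le' h1)
  have h2ν : 2 < ν := by
    by_contra! h
    exact (hνS.trans (power_le_power_right h)).not_gt h2
  have h2I := hmin 2 h2ν
  have hIν : #I < ν := (cantor _).trans h2I
  have hν : ℵ₀ ≤ ν := hreg.aleph0_le.trans hIν.le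
  have hcof : ν.ord.cof ≤ #I :=
    cof_le_of_lt_power hmin hν (hνA.trans_lt (hA.trans_le hνS))
  have hsing : ν.IsSingular := ⟨hν, (hcof.trans_lt hIν).ne⟩
  have hsch := hSCH ν hsing
    ((power_le_power_left two_ne_zero hcof).trans_lt h2I)
  have hθ : θ = succ ν := by
    refine le_antisymm ?_ (succ_le_of_lt (hνA.trans_lt hA))
    exact (hνS.trans (power_le_power_cof hmin hν)).trans_eq hsch
  refine ⟨ν, hθ, hsing, hcof.antisymm ?_⟩
  -- Since `#A < θ = ν⁺`, the values may be taken in `ν` itself.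
  have hAν : #A ≤ #ν.ord.ToType := by
    rw [mk_toType, card_ord]
    exact lt_succ_iff.1 (hθ ▸ hA)
  obtain ⟨e⟩ := hAν
  refine le_cof_of_eventually_different hmin hν hreg (cof_ord_le ν)
    ((lt_succ ν).trans_le (hθ ▸ hB)) (fun b i => e (g b i)) fun b b' h => ?_
  simpa using hg b b' h

end Cardinals

/-! ### Families of eventually different functions -/

section EventuallyDifferent

open Cardinal Order

/-- Diagonalization: with `P` embedded in `W`, the value `g i` avoids `f p i` only for those `p`
lying below `c i`. These are fewer than `#W`, and every `p` is eventually among them. -/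
theorem exists_eventually_different_step {I W P : Type u} [LinearOrder I] [LinearOrder W]
    [WellFoundedLT W] (hW : ∀ w : W, #(Set.Iio w) < #W) [NoMaxOrder W] {c : I → W}
    (hc : StrictMono c) (hc' : IsCofinal (Set.range c)) (hP : #P ≤ #W) (f : P → I → W) :
    ∃ g : I → W, ∀ p, ∃ i₀, ∀ i, i₀ < i → g i ≠ f p i := by
  obtain ⟨e⟩ := hP
  have h (i : I) : ∃ w, w ∉ (fun p => f p i) '' {p | e p < c i} := by
    by_contra! h
    have h1 : #W ≤ #{p | e p < c i} := by
      rw [← mk_univ, ← Set.eq_univ_of_forall h]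
      exact mk_image_le
    have h2 : #{p | e p < c i} ≤ #(Set.Iio (c i)) :=
      mk_le_of_injective (f := fun p => (⟨e p.1, p.2⟩ : Set.Iio (c i))) fun p q hpq =>
        Subtype.ext (e.injective (congrArg Subtype.val hpq))
    exact (h1.trans h2).not_gt (hW _)
  choose g hg using h
  refine ⟨g, fun p => ?_⟩
  obtain ⟨w, hw⟩ := exists_gt (e p)
  obtain ⟨_, ⟨i₀, rfl⟩, h⟩ := hc' w
  exact ⟨i₀, fun i hi hgi => hg i ⟨p, (hw.trans_le h).trans (hc hi), hgi.symm⟩⟩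

/-- Recursion of length `c⁺`: each stage has at most `c` predecessors, so the diagonalization step
applies. -/
theorem exists_eventually_different {c : Cardinal.{u}} (hc : ℵ₀ ≤ c) :
    ∃ g : (succ c).ord.ToType → c.ord.cof.ord.ToType → c.ord.ToType,
      ∀ d d', d ≠ d' → ∃ i₀, ∀ i, i₀ < i → g d i ≠ g d' i := by
  have : NoMaxOrder c.ord.ToType := Cardinal.noMaxOrder hc
  obtain ⟨s, hs, hs'⟩ := exists_ord_cof_eq c.ord.ToType
  have h : typeLT c.ord.cof.ord.ToType = typeLT s := by
    rw [hs', type_toType, cof_toType]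
  obtain ⟨r⟩ := type_eq.1 h
  let r := OrderIso.ofRelIsoLT r
  have hr : StrictMono fun i => (r i).1 := fun i k h => r.strictMono h
  have hr' : IsCofinal (Set.range fun i => (r i).1) := by
    intro w
    obtain ⟨x, hx, hwx⟩ := hs w
    exact ⟨x, ⟨r.symm ⟨x, hx⟩, by simp⟩, hwx⟩
  have hW (w : c.ord.ToType) : #(Set.Iio w) < #c.ord.ToType := mk_Iio_lt w (by simp)
  have hstep (d : (succ c).ord.ToType)
      (f : ∀ d' : (succ c).ord.ToType, d' < d → c.ord.cof.ord.ToType → c.ord.ToType) :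
      ∃ g : c.ord.cof.ord.ToType → c.ord.ToType,
        ∀ d' h, ∃ i₀, ∀ i, i₀ < i → g i ≠ f d' h i := by
    have hd : #(Set.Iio d) ≤ #c.ord.ToType := by
      have : #(Set.Iio d) < #(succ c).ord.ToType := mk_Iio_lt d (by simp)
      rw [mk_toType, card_ord] at this ⊢
      exact lt_succ_iff.1 this
    obtain ⟨g, hg⟩ := exists_eventually_different_step hW hr hr' hd fun p => f p.1 p.2
    exact ⟨g, fun d' h => hg ⟨d', h⟩⟩
  choose F hF using hstep
  have key (d d' : (succ c).ord.ToType) (h : d' < d) : ∃ i₀, ∀ i, i₀ < i →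
      wellFounded_lt.fix F d i ≠ wellFounded_lt.fix F d' i := by
    conv in wellFounded_lt.fix F d _ => rw [WellFounded.fix_eq]
    exact hF d (fun d' _ => wellFounded_lt.fix F d') d' h
  refine ⟨wellFounded_lt.fix F, fun d d' h => ?_⟩
  rcases lt_or_gt_of_ne h with h | h
  · obtain ⟨i₀, h⟩ := key _ _ h
    exact ⟨i₀, fun i hi => (h i hi).symm⟩
  · exact key _ _ h

end EventuallyDifferent

/-! ### The relativized notions evaluated in `V` -/

section Universe

open ZFSet Cardinal

/-- The graph of a function restricted to a set. -/
noncomputable def funGraph (x : ZFSet.{u}) (F : ZFSet.{u} → ZFSet.{u}) : ZFSet.{u} :=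
  ZFSet.range fun a : x => pair a.1 (F a.1)

@[simp] theorem pair_mem_funGraph {x a b : ZFSet.{u}} {F : ZFSet.{u} → ZFSet.{u}} :
    pair a b ∈ funGraph x F ↔ a ∈ x ∧ b = F a := by
  simp only [funGraph, ZFSet.mem_range, pair_inj, Subtype.exists]
  constructor
  · rintro ⟨_, h, rfl, rfl⟩
    exact ⟨h, rfl⟩
  · rintro ⟨h, rfl⟩
    exact ⟨a, h, rfl, rfl⟩

theorem isFunc_funGraph {x y : ZFSet.{u}} {F : ZFSet.{u} → ZFSet.{u}} (h : ∀ a ∈ x, F a ∈ y) :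
    IsFunc x y (funGraph x F) := by
  refine ⟨fun p hp => ?_, fun a ha => ⟨F a, by simp [ha], fun b hb => ?_⟩⟩
  · obtain ⟨a, rfl⟩ := ZFSet.mem_range.1 hp
    exact pair_mem_prod.2 ⟨a.2, h _ a.2⟩
  · exact (pair_mem_funGraph.1 hb).2

theorem exists_fun_of_isFunc {x y f : ZFSet.{u}} (h : IsFunc x y f) :
    ∃ F : x → y, ∀ a : x, ∀ b, pair a.1 b ∈ f ↔ b = F a := by
  have (a : x) : ∃ b : y, ∀ c, pair a.1 c ∈ f ↔ c = b := by
    obtain ⟨b, hb, hb'⟩ := h.2 a.1 a.2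
    refine ⟨⟨b, (pair_mem_prod.1 (h.1 hb)).2⟩, fun c => ⟨hb' c, ?_⟩⟩
    rintro rfl
    exact hb
  choose F hF using this
  exact ⟨F, hF⟩

theorem mk_toZFSet (α : Ordinal.{u}) : #α.toZFSet = Cardinal.lift.{u + 1} α.card := by
  rw [cardinalMk_coe_sort, card_toZFSet]

theorem equinumerousIn_univ_iff {α β : Ordinal.{u}} :
    EquinumerousIn Set.univ α β ↔ α.card = β.card := by
  rw [← Cardinal.lift_inj.{u, u + 1}, ← mk_toZFSet, ← mk_toZFSet, Cardinal.eq]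
  constructor
  · rintro ⟨f, -, hf, h⟩
    obtain ⟨F, hF⟩ := exists_fun_of_isFunc hf
    refine ⟨Equiv.ofBijective F ⟨fun a b hab => ?_, fun b => ?_⟩⟩
    · obtain ⟨c, -, hc⟩ := h (F a) (F a).2
      exact Subtype.ext ((hc _ ((hF _ _).2 rfl)).trans (hc _ ((hF _ _).2 (by rw [hab]))).symm)
    · obtain ⟨c, hc, -⟩ := h b b.2
      have hcα := (pair_mem_prod.1 (hf.1 hc)).1
      exact ⟨⟨c, hcα⟩, Subtype.ext ((hF ⟨c, hcα⟩ _).1 hc).symm⟩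
  · rintro ⟨e⟩
    classical
    let F : ZFSet.{u} → ZFSet.{u} := fun a => if h : a ∈ α.toZFSet then e ⟨a, h⟩ else ∅
    have hF (a : ZFSet.{u}) (h : a ∈ α.toZFSet) : F a = e ⟨a, h⟩ := dif_pos h
    refine ⟨funGraph α.toZFSet F, trivial, isFunc_funGraph fun a ha => ?_, fun b hb => ?_⟩
    · rw [hF a ha]
      exact (e _).2
    · refine ⟨e.symm ⟨b, hb⟩, pair_mem_funGraph.2 ⟨(e.symm ⟨b, hb⟩).2, ?_⟩, fun c hc => ?_⟩
      · rw [hF _ (e.symm ⟨b, hb⟩).2]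
        simp
      · obtain ⟨h1, h2⟩ := pair_mem_funGraph.1 hc
        rw [hF c h1] at h2
        subst h2
        simp

theorem exists_cofinal_fun {α β : Ordinal.{u}} (hβ : β ≠ 0) (h : β.cof ≤ α.card) :
    ∃ F : Ordinal.{u} → Ordinal.{u}, (∀ ξ, F ξ < β) ∧ ∀ γ < β, ∃ ξ < α, γ ≤ F ξ := by
  obtain ⟨S, hS, hS'⟩ := Order.exists_cof_eq β.ToType
  have hne : Nonempty β.ToType := nonempty_toType_iff.2 hβ
  obtain ⟨s, hs, -⟩ := hS hne.some
  have : Nonempty S := ⟨⟨s, hs⟩⟩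
  have hle : #S ≤ #α.ToType := by rwa [hS', cof_toType, mk_toType]
  obtain ⟨e⟩ := hle
  let G : α.ToType → S := Function.invFun e
  have hG : Function.Surjective G := Function.invFun_surjective e.injective
  classical
  -- The default `0` makes the map total, with values still below `β ≠ 0`.
  refine ⟨fun ξ => if hξ : ξ ∈ Set.Iio α then (ToType.mk.symm (G (ToType.mk ⟨ξ, hξ⟩)).1).1 else 0,
    fun ξ => ?_, fun γ hγ => ?_⟩
  · dsimp only
    split_ifs
    · exact (ToType.mk.symm _).2
    · exact pos_iff_ne_zero.2 hβ
  · obtain ⟨b, hb, hγb⟩ := hS (ToType.mk ⟨γ, hγ⟩)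
    obtain ⟨a, ha⟩ := hG ⟨b, hb⟩
    refine ⟨(ToType.mk.symm a).1, (ToType.mk.symm a).2, ?_⟩
    have h1 : (ToType.mk.symm a).1 ∈ Set.Iio α := (ToType.mk.symm a).2
    dsimp only
    rw [dif_pos h1]
    have h2 : ToType.mk ⟨(ToType.mk.symm a).1, h1⟩ = a := ToType.mk.apply_symm_apply a
    rw [h2, ha]
    have h3 := ToType.mk.symm.monotone hγb
    rw [OrderIso.symm_apply_apply] at h3
    exact h3

theorem cof_le_card_of_cofinal {β : Ordinal.{u}} {T : Type u} (F : T → Ordinal.{u})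
    (h : ∀ γ < β, ∃ t, γ ≤ F t ∧ F t < β) : β.cof ≤ #T := by
  rw [← cof_toType]
  refine (Order.cof_le (s := {b | ∃ t, F t = (ToType.mk.symm b).1}) fun b => ?_).trans ?_
  · obtain ⟨t, h1, h2⟩ := h (ToType.mk.symm b).1 (ToType.mk.symm b).2
    refine ⟨ToType.mk ⟨F t, h2⟩, ⟨t, by simp⟩, ?_⟩
    have : ToType.mk.symm b ≤ ⟨F t, h2⟩ := h1
    simpa using ToType.mk.monotone this
  · refine mk_le_of_injective (f := fun b => b.2.choose) fun a b hab => ?_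
    have h1 := a.2.choose_spec
    have h2 := b.2.choose_spec
    dsimp only at hab
    rw [hab] at h1
    exact Subtype.ext (ToType.mk.symm.injective (Subtype.ext (h1.symm.trans h2)))

/-- The case `β = 0` must be excluded: a nonzero `α` has no function into the empty set, although
`cf 0 = 0`. -/
theorem cofinalMapIn_univ_iff {α β : Ordinal.{u}} (hβ : β ≠ 0) :
    CofinalMapIn Set.univ α β ↔ β.cof ≤ α.card := by
  constructor
  · rintro ⟨f, -, hf, h⟩
    obtain ⟨F, hF⟩ := exists_fun_of_isFunc hf
    rw [← mk_toType]
    refine cof_le_card_of_cofinal (fun a => (F ⟨(ToType.mk.symm a).1.toZFSet,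
      toZFSet_mem_toZFSet_iff.2 (ToType.mk.symm a).2⟩).1.rank) fun γ hγ => ?_
    obtain ⟨ξ, hξ, ζ, hζ, hγζ, hp⟩ := h γ hγ
    refine ⟨ToType.mk ⟨ξ, hξ⟩, ?_⟩
    have := (hF ⟨ξ.toZFSet, toZFSet_mem_toZFSet_iff.2 hξ⟩ _).1 hp
    simp only [OrderIso.symm_apply_apply, ← this, rank_toZFSet]
    exact ⟨hγζ, hζ⟩
  · intro h
    obtain ⟨F, hF, hF'⟩ := exists_cofinal_fun hβ h
    refine ⟨funGraph α.toZFSet fun x => (F x.rank).toZFSet, trivial,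
      isFunc_funGraph fun a _ => toZFSet_mem_toZFSet_iff.2 (hF _), fun γ hγ => ?_⟩
    obtain ⟨ξ, hξ, h⟩ := hF' γ hγ
    exact ⟨ξ, hξ, F ξ, hF ξ, h, pair_mem_funGraph.2
      ⟨toZFSet_mem_toZFSet_iff.2 hξ, by rw [rank_toZFSet]⟩⟩

theorem isCofIn_univ {β : Ordinal.{u}} (hβ : β ≠ 0) : IsCofIn Set.univ β β.cof.ord := by
  constructor
  · exact (cofinalMapIn_univ_iff hβ).2 (card_ord _).ge
  · intro α hα
    exact ord_le.2 ((cofinalMapIn_univ_iff hβ).1 hα)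

theorem isCardinalIn_univ (c : Cardinal.{u}) : IsCardinalIn Set.univ c.ord := by
  intro α hα h
  rw [equinumerousIn_univ_iff, card_ord] at h
  exact (lt_ord.1 hα).ne h

theorem isSuccCardinalIn_univ (c : Cardinal.{u}) :
    IsSuccCardinalIn Set.univ c.ord (Order.succ c).ord := by
  refine ⟨⟨isCardinalIn_univ _, ord_lt_ord.2 (Order.lt_succ c)⟩, fun θ ⟨h1, h2⟩ => ?_⟩
  rw [ord_le, Order.succ_le_iff]
  have h3 : c ≤ θ.card := ord_le.1 h2.le
  refine h3.lt_of_ne fun h => h1 c.ord h2 ?_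
  rw [equinumerousIn_univ_iff, card_ord, h]

theorem cofIsSuccIn_univ {σ : Ordinal.{u}} {c : Cardinal.{u}} (hσ : σ.cof = Order.succ c)
    (hc : c.IsSingular) : CofIsSuccIn Set.univ σ c.ord.cof.ord := by
  have h0 : σ ≠ 0 := by
    rintro rfl
    rw [cof_zero] at hσ
    exact (Order.succ_ne_bot c) (by rw [← hσ]; rfl)
  have h1 : c.ord ≠ 0 := by
    rw [Ne, ord_eq_zero]
    exact hc.pos.ne'
  refine ⟨σ.cof.ord, ord_cof_le σ, isCofIn_univ h0, c.ord, ?_, ?_, isCardinalIn_univ c,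
    ord_lt_ord.2 hc.cof_ord_lt, isCofIn_univ h1⟩
  · rw [hσ]
    exact ord_lt_ord.2 (Order.lt_succ c)
  · rw [hσ]
    exact isSuccCardinalIn_univ c

end Universe

/-! ### Clubs with small initial segments, and the principle for ordinals -/

section Club

open Cardinal Order

/-- The club consists of the suprema of the proper initial segments of a cofinal `cf σ`-sequence.
Its part below any `e < σ` is enumerated by a proper initial segment of the index set, which is how
its smallness is expressed. -/
theorem exists_club {σ : Ordinal.{u}} (hσ : IsSuccLimit σ) :
    ∃ C : Set Ordinal.{u}, (∀ x ∈ C, x < σ) ∧ (∀ y < σ, ∃ z ∈ C, y < z) ∧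
      (∀ x < σ, (∀ y < x, ∃ z ∈ C, y < z ∧ z < x) → x ∈ C) ∧
      ∀ e < σ, ∃ ξ : Ordinal.{u}, ξ.card < σ.cof ∧ ∃ c : Ordinal.{u} → Ordinal.{u},
        ∀ z ∈ C, z < e → ∃ ζ < ξ, c ζ = z := by
  have ha : IsSuccLimit σ.cof.ord := isSuccLimit_ord (not_lt.1 fun h => (Ordinal.one_lt_cof_iff.2 hσ).not_ge (cof_lt_aleph0_iff.1 h))
  obtain ⟨F, hF, hF'⟩ := exists_cofinal_fun (α := σ.cof.ord) (β := σ) hσ.ne_bot (card_ord _).ge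
  let c : Ordinal.{u} → Ordinal.{u} := fun ξ => ⨆ ζ : Set.Iio ξ, F ζ.1
  have hle {ζ ξ : Ordinal.{u}} (h : ζ < ξ) : F ζ ≤ c ξ :=
    Ordinal.le_iSup (fun ζ : Set.Iio ξ => F ζ.1) ⟨ζ, h⟩
  have hlt {x ξ : Ordinal.{u}} (h : x < c ξ) : ∃ ζ < ξ, x < F ζ := by
    obtain ⟨ζ, h⟩ := Ordinal.lt_iSup_iff.1 h
    exact ⟨ζ.1, ζ.2, h⟩
  have hmono : Monotone c := fun ξ ξ' h =>
    Ordinal.iSup_le fun ζ => hle (lt_of_lt_of_le ζ.2 h)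
  have hcσ (ξ : Ordinal.{u}) (hξ : ξ < σ.cof.ord) : c ξ < σ := by
    refine lift_iSup_lt_of_lt_cof ?_ fun ζ => hF ζ.1
    rw [Cardinal.mk_Iio_ordinal, Cardinal.lift_lift, ← lift_cof, Cardinal.lift_lt]
    exact lt_ord.1 hξ
  have hunb (y : Ordinal.{u}) (hy : y < σ) : ∃ ξ < σ.cof.ord, y < c ξ := by
    obtain ⟨ξ, hξ, h⟩ := hF' _ (hσ.succ_lt hy)
    exact ⟨succ ξ, ha.succ_lt hξ, (lt_succ y).trans_le (h.trans (hle (lt_succ ξ)))⟩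
  refine ⟨c '' Set.Iio σ.cof.ord, ?_, fun y hy => ?_, fun x hx h => ?_, fun e he => ?_⟩
  · rintro _ ⟨ξ, hξ, rfl⟩
    exact hcσ ξ hξ
  · obtain ⟨ξ, hξ, h⟩ := hunb y hy
    exact ⟨_, ⟨ξ, hξ, rfl⟩, h⟩
  · obtain ⟨ξ, ⟨hξ, hxξ⟩, hmin⟩ := wellFounded_lt.has_min {ξ | ξ < σ.cof.ord ∧ x < c ξ} (hunb x hx)
    obtain ⟨ζ, hζ, hxζ⟩ := hlt hxξ
    have hζa := hζ.trans hξ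
    have h1 : c ζ ≤ x := not_lt.1 fun h => hmin ζ ⟨hζa, h⟩ hζ
    rcases h1.eq_or_lt with h1 | h1
    · exact ⟨ζ, hζa, h1⟩
    -- A member of the club strictly between `c ζ` and `x` has index above `ζ`, hence is at least `F
    -- ζ > x`.
    · obtain ⟨_, ⟨ξ', hξ', rfl⟩, h2, h3⟩ := h _ h1
      have h4 : ζ < ξ' := hmono.reflect_lt h2
      exact absurd (hxζ.trans_le (hle h4)) h3.not_gt
  · obtain ⟨ξ, hξ, h⟩ := hunb e he
    refine ⟨ξ, lt_ord.1 hξ, c, ?_⟩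
    rintro _ ⟨ζ, hζ, rfl⟩ hz
    exact ⟨ζ, hmono.reflect_lt (hz.trans h), rfl⟩

/-- Here `A = C ∩ ε` is small because it is enumerated along `ξ`, and the set `B` of good indices
has size at least `cf σ` because it is unbounded. Choosing values of `R` gives functions whose
agreement sets are bounded in `ι`, as the cardinal arithmetic requires. -/
theorem cof_eq_succ_of_family (hSCH : SCH.{u}) {ι : Cardinal.{u}} (hι : ι.IsRegular)
    {σ ε ξ : Ordinal.{u}} (hε : ε < σ) {C : Set Ordinal.{u}} (h2 : 2 ^ ι < σ.cof)
    (hξ : ξ.card < σ.cof) {c : Ordinal.{u} → Ordinal.{u}}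
    (hC : ∀ z ∈ C, z < ε → ∃ ζ < ξ, c ζ = z) (R : Ordinal.{u} → Ordinal.{u} → Ordinal.{u} → Prop)
    (hR : ∀ α < σ, ∀ β < σ, α ≠ β → ∃ i₀ < ι.ord, ∀ i < ι.ord, i₀ < i → ∀ x, R α i x → ¬ R β i x)
    (hbig : ∀ y < σ, ∃ α < σ, y < α ∧ ∀ i < ι.ord, ∃ x ∈ C, x < ε ∧ R α i x) :
    ∃ ν : Cardinal.{u}, σ.cof = succ ν ∧ ν.IsSingular ∧ ν.ord.cof = ι := by
  have hI : #ι.ord.ToType = ι := by rw [mk_toType, card_ord]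
  have : NoMaxOrder ι.ord.ToType := Cardinal.noMaxOrder hι.aleph0_le
  let val {o : Ordinal.{u}} (b : o.ToType) : Ordinal.{u} := (ToType.mk.symm b).1
  have hval {o : Ordinal.{u}} (b : o.ToType) : val b < o := (ToType.mk.symm b).2
  have hinj {o : Ordinal.{u}} {b b' : o.ToType} (h : val b = val b') : b = b' :=
    ToType.mk.symm.injective (Subtype.ext h)
  let A := {a : σ.ToType // val a ∈ C ∧ val a < ε}
  let B := {b : σ.ToType // ∀ i < ι.ord, ∃ x ∈ C, x < ε ∧ R (val b) i x}
  have hA : #A < σ.cof := by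
    choose f hf hf' using fun a : A => hC _ a.2.1 a.2.2
    rw [← mk_toType] at hξ
    refine (mk_le_of_injective (f := fun a : A => ToType.mk ⟨f a, hf a⟩) fun a b hab => ?_).trans_lt hξ
    have := congrArg Subtype.val (ToType.mk.injective hab)
    dsimp only at this
    exact Subtype.ext (hinj (by rw [← hf', ← hf', this]))
  have hB : σ.cof ≤ #B := by
    rw [← cof_toType]
    refine Order.cof_le (s := {b | ∀ i < ι.ord, ∃ x ∈ C, x < ε ∧ R (val b) i x}) fun b => ?_
    obtain ⟨α, hα, hbα, h⟩ := hbig _ (hval b)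
    refine ⟨ToType.mk ⟨α, hα⟩, ?_, ?_⟩
    · simpa [val] using h
    · rw [← ToType.mk.symm.le_iff_le, OrderIso.symm_apply_apply]
      exact hbα.le
  have hg (b : B) (i : ι.ord.ToType) : ∃ a : A, R (val b.1) (val i) (val a.1) := by
    obtain ⟨x, hx, hxε, h⟩ := b.2 (val i) (hval i)
    have : val (ToType.mk ⟨x, hxε.trans hε⟩ : σ.ToType) = x := by simp [val]
    exact ⟨⟨ToType.mk ⟨x, hxε.trans hε⟩, by rw [this]; exact ⟨hx, hxε⟩⟩, by rw [this]; exact h⟩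
  choose g hg using hg
  obtain ⟨ν, h⟩ := eq_succ_of_eventually_different hSCH (I := ι.ord.ToType) (by rwa [hI]) hA hB
    (by rwa [hI]) g fun b b' hbb => by
      obtain ⟨i₀, hi₀, h⟩ := hR _ (hval b.1) _ (hval b'.1) fun h => hbb (Subtype.ext (hinj h))
      obtain ⟨i₁, hi₁⟩ := exists_gt (ToType.mk ⟨i₀, hi₀⟩ : ι.ord.ToType)
      refine (mk_le_mk_of_subset fun i hi => ?_).trans_lt (mk_Iio_lt i₁ (by simp))
      by_contra hlt
      have h1 : ToType.mk ⟨i₀, hi₀⟩ < i := hi₁.trans_le (not_lt.1 hlt)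
      have h2 : i₀ < val i := by
        rw [← ToType.mk.symm.lt_iff_lt, OrderIso.symm_apply_apply] at h1
        exact h1
      refine h _ (hval i) h2 _ (hg b i) ?_
      have hi : g b i = g b' i := hi
      rw [hi]
      exact hg b' i
  exact ⟨ν, by rwa [hI] at h⟩

/-- If `cf σ ≤ 2 ^ ι`, a cofinal map from `2 ^ ι` to `σ`, reindexed by the subsets of `ι`, is an `H`
violating the hypothesis. -/
theorem two_power_lt_cof {ι : Cardinal.{u}} {σ : Ordinal.{u}} (hσ : σ ≠ 0)
    (h : ∀ H : ZFSet.{u}, (∀ a y y', ZFSet.pair a y ∈ H → ZFSet.pair a y' ∈ H → y = y') →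
      ∃ b ∈ σ.toZFSet, ∀ a ⊆ ι.ord.toZFSet, ∀ y ∈ σ.toZFSet, ZFSet.pair a y ∈ H → y ∈ b) :
    2 ^ ι < σ.cof := by
  by_contra! hle
  obtain ⟨F, hF, hF'⟩ := exists_cofinal_fun (α := ((2 : Cardinal.{u}) ^ ι).ord) hσ (by rwa [card_ord])
  have hP : #ι.ord.toZFSet.powerset = #((2 : Cardinal.{u}) ^ ι).ord.toZFSet := by
    rw [mk_toZFSet, ZFSet.cardinalMk_coe_sort, ZFSet.card_powerset, card_toZFSet, card_ord,
      card_ord]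
  obtain ⟨e⟩ := Cardinal.eq.1 hP
  classical
  let G : ZFSet.{u} → ZFSet.{u} := fun a => if ha : a ∈ ι.ord.toZFSet.powerset then
    (F (e ⟨a, ha⟩).1.rank).toZFSet else ∅
  obtain ⟨b, hb, hbig⟩ := h (funGraph ι.ord.toZFSet.powerset G) fun a y y' h h' =>
    (pair_mem_funGraph.1 h).2.trans (pair_mem_funGraph.1 h').2.symm
  obtain ⟨β, hβ, rfl⟩ := mem_toZFSet_iff.1 hb
  obtain ⟨ξ, hξ, h1⟩ := hF' β hβ
  let a := e.symm ⟨ξ.toZFSet, toZFSet_mem_toZFSet_iff.2 hξ⟩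
  have hG : G a.1 = (F ξ).toZFSet := by
    dsimp only [G]
    rw [dif_pos a.2]
    simp [a]
  have h2 := hbig a.1 (ZFSet.mem_powerset.1 a.2) (F ξ).toZFSet
    (toZFSet_mem_toZFSet_iff.2 (hF ξ)) (pair_mem_funGraph.2 ⟨a.2, hG.symm⟩)
  exact h1.not_gt (toZFSet_mem_toZFSet_iff.1 h2)

end Club

/-! ### The club principle as a formula -/

namespace SetFormula

/-- The functions coded by the ternary relation `r` at the elements of `s` are eventually different
on `i`. -/
def eventuallyDifferent (r s i : ℕ) : SetFormula :=
  .all (.imp (.mem 0 (s + 1)) (.all (.imp (.mem 0 (s + 2)) (.imp (.not (.eq 1 0))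
    (.ex (.and (.mem 0 (i + 3)) (.all (.imp (.mem 0 (i + 4)) (.imp (.mem 1 0)
      (.all (.imp (tripleMem 4 1 0 (r + 5)) (.not (tripleMem 3 1 0 (r + 5))))))))))))))

/-- `s` is a limit ordinal. -/
def isLimit (s : ℕ) : SetFormula :=
  .and (isOrdinal s) (.and (.ex (.mem 0 (s + 1)))
    (.all (.imp (.mem 0 (s + 1)) (.ex (.and (.mem 0 (s + 2)) (.mem 1 0))))))

/-- `c` is unbounded in `s` and contains its limit points. -/
def isClub (c s : ℕ) : SetFormula :=
  .and (.all (.imp (.mem 0 (s + 1)) (.ex (.and (.mem 0 (c + 2)) (.and (.mem 0 (s + 2)) (.mem 1 0))))))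
    (.all (.imp (.mem 0 (s + 1)) (.imp (.all (.imp (.mem 0 1)
      (.ex (.and (.mem 0 (c + 3)) (.and (.mem 1 0) (.mem 0 2)))))) (.mem 0 (c + 1)))))

/-- For unboundedly many `α ∈ s`, the function on `i` coded by `r` at `α` has values in `c ∩ e`. -/
def manyValues (r e c s i : ℕ) : SetFormula :=
  .all (.imp (.mem 0 (s + 1)) (.ex (.and (.mem 0 (s + 2)) (.and (.mem 1 0)
    (.all (.imp (.mem 0 (i + 3)) (.ex (.and (.mem 0 (c + 4)) (.and (.mem 0 (e + 4))
      (tripleMem 2 1 0 (r + 4)))))))))))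

/-- No function from the subsets of `i` to `s` is unbounded. -/
def powersetBounded (s i : ℕ) : SetFormula :=
  .all (.imp (.all (.all (.all (.imp (pairMem 2 1 3) (.imp (pairMem 2 0 3) (.eq 1 0))))))
    (.ex (.and (.mem 0 (s + 2)) (.all (.imp (.all (.imp (.mem 0 1) (.mem 0 (i + 4))))
      (.all (.imp (.mem 0 (s + 4)) (.imp (pairMem 1 0 3) (.mem 0 2)))))))))

/-- Every limit ordinal `s` has a club `c` such that, if there are unboundedly many eventually
different functions from `i` to a proper initial segment of `c`, then the cofinality of `s` is the
successor of a singular cardinal of cofinality `i`. -/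
def clubPrinciple (i : ℕ) : SetFormula :=
  .all (.imp (isLimit 0) (.ex (.and (isClub 0 1) (.all (.imp (.mem 0 2) (.all
    (.imp (eventuallyDifferent 0 3 (i + 4)) (.imp (manyValues 0 1 2 3 (i + 4))
      (.imp (powersetBounded 3 (i + 4)) (cofIsSucc 3 (i + 4)))))))))))

end SetFormula

/-! ### The club principle holds in `V` -/

section ClubPrinciple

open ZFSet SetFormula

theorem sat_eventuallyDifferent {N : Set ZFSet.{u}} (hN : IsPairingClass N) (v : ℕ → N)
    (r s i : ℕ) : Sat v (eventuallyDifferent r s i) ↔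
      ∀ α : N, α.1 ∈ (v s).1 → ∀ β : N, β.1 ∈ (v s).1 → α.1 ≠ β.1 → ∃ i₀ : N, i₀.1 ∈ (v i).1 ∧
        ∀ k : N, k.1 ∈ (v i).1 → i₀.1 ∈ k.1 → ∀ x : N,
          pair (pair α k) x ∈ (v r).1 → pair (pair β k) x ∉ (v r).1 := by
  simp only [eventuallyDifferent, Sat, sat_tripleMem hN]
  exact Iff.rfl

theorem sat_eventuallyDifferent_univ (v : ℕ → (Set.univ : Set ZFSet.{u}).Elem) (r s i : ℕ) :
    Sat v (eventuallyDifferent r s i) ↔ ∀ α ∈ (v s).1, ∀ β ∈ (v s).1, α ≠ β → ∃ i₀ ∈ (v i).1,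
      ∀ k ∈ (v i).1, i₀ ∈ k → ∀ x, pair (pair α k) x ∈ (v r).1 → pair (pair β k) x ∉ (v r).1 := by
  simp only [sat_eventuallyDifferent isPairingClass_univ, forall_univ_iff, exists_univ_iff]
  exact Iff.rfl

/-- This is the only transferred statement that relies on SCH: the club is that of `exists_club`,
and the conclusion comes from `cof_eq_succ_of_family`. -/
theorem sat_clubPrinciple_univ (hSCH : SCH.{u}) {ι : Cardinal.{u}} (hι : ι.IsRegular)
    (v : ℕ → (Set.univ : Set ZFSet.{u}).Elem) (i : ℕ) (hi : (v i).1 = ι.ord.toZFSet) :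
    Sat v (clubPrinciple i) := by
  simp only [clubPrinciple, Sat]
  intro s hs
  simp only [isLimit, Sat, sat_isOrdinal isPairingClass_univ, forall_univ_iff,
    exists_univ_iff] at hs
  obtain ⟨hs, ⟨z, hz⟩, hlim⟩ := hs
  have hz : z ∈ s.1 := hz
  have hlim : ∀ y ∈ s.1, ∃ z ∈ s.1, y ∈ z := hlim
  obtain ⟨σ, hσs⟩ : ∃ σ : Ordinal.{u}, s.1 = σ.toZFSet := ⟨_, (IsOrdinal.toZFSet_rank_eq hs).symm⟩
  rw [hσs] at hz hlim
  have hσ : Order.IsSuccLimit σ := by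
    rw [Order.isSuccLimit_iff, Order.isSuccPrelimit_iff_succ_lt]
    constructor
    · obtain ⟨ζ, hζ, -⟩ := mem_toZFSet_iff.1 hz
      exact not_isMin_of_lt hζ
    · intro ζ hζ
      obtain ⟨x, hx, hζx⟩ := hlim _ (toZFSet_mem_toZFSet_iff.2 hζ)
      obtain ⟨ξ, hξ, rfl⟩ := mem_toZFSet_iff.1 hx
      exact (Order.succ_le_of_lt (toZFSet_mem_toZFSet_iff.1 hζx)).trans_lt hξ
  obtain ⟨C, hCσ, hCunb, hCcl, hCsmall⟩ := exists_club hσ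
  let c : ZFSet.{u} := ZFSet.sep (fun x => x.rank ∈ C) σ.toZFSet
  have hc (ζ : Ordinal.{u}) (h : ζ ∈ C) : ζ.toZFSet ∈ c := by
    simp [c, hCσ ζ h, h]
  refine ⟨up c, ?_, ?_⟩
  · simp only [isClub, Sat, forall_univ_iff, exists_univ_iff]
    change (∀ y ∈ s.1, ∃ z, z ∈ c ∧ z ∈ s.1 ∧ y ∈ z) ∧ ∀ x ∈ s.1,
      (∀ y ∈ x, ∃ z, z ∈ c ∧ y ∈ z ∧ z ∈ x) → x ∈ c
    rw [hσs]
    constructor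
    · intro y hy
      obtain ⟨ζ, hζ, rfl⟩ := mem_toZFSet_iff.1 hy
      obtain ⟨ξ, hξ, h⟩ := hCunb ζ hζ
      exact ⟨_, hc ξ hξ, toZFSet_mem_toZFSet_iff.2 (hCσ ξ hξ), toZFSet_mem_toZFSet_iff.2 h⟩
    · intro x hx h
      obtain ⟨ξ, hξ, rfl⟩ := mem_toZFSet_iff.1 hx
      refine hc _ (hCcl ξ hξ fun ζ hζ => ?_)
      obtain ⟨z, hz, h1, h2⟩ := h _ (toZFSet_mem_toZFSet_iff.2 hζ)
      obtain ⟨χ, hχ, rfl⟩ := mem_toZFSet_iff.1 h2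
      refine ⟨χ, ?_, toZFSet_mem_toZFSet_iff.1 h1, hχ⟩
      simpa [c] using (mem_sep.1 hz).2
  · intro e he R hED hmany hpow
    rw [sat_eventuallyDifferent_univ] at hED
    simp only [manyValues, powersetBounded, Sat, sat_tripleMem isPairingClass_univ,
      sat_pairMem isPairingClass_univ, forall_univ_iff, exists_univ_iff] at hmany hpow
    have hED : ∀ α ∈ s.1, ∀ β ∈ s.1, α ≠ β → ∃ i₀ ∈ (v i).1, ∀ k ∈ (v i).1, i₀ ∈ k →
      ∀ x, pair (pair α k) x ∈ R.1 → pair (pair β k) x ∉ R.1 := hED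
    have hmany : ∀ y ∈ s.1, ∃ α, α ∈ s.1 ∧ y ∈ α ∧ ∀ k ∈ (v i).1, ∃ x, x ∈ c ∧ x ∈ e.1 ∧
      pair (pair α k) x ∈ R.1 := hmany
    have hpow : ∀ H, (∀ a y y', pair a y ∈ H → pair a y' ∈ H → y = y') → ∃ b, b ∈ s.1 ∧
      ∀ a : ZFSet.{u}, (∀ z, z ∈ a → z ∈ (v i).1) → ∀ y ∈ s.1, pair a y ∈ H → y ∈ b := hpow
    have he : e.1 ∈ s.1 := he
    rw [hσs] at hED hmany hpow he
    rw [hi] at hED hmany hpow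
    obtain ⟨ε, hε, hεe⟩ := mem_toZFSet_iff.1 he
    rw [← hεe] at hmany
    obtain ⟨ξ, hξ, f, hf⟩ := hCsmall ε hε
    have h2 := two_power_lt_cof (ι := ι) hσ.ne_bot hpow
    obtain ⟨ν, hν, hsing, rfl⟩ := cof_eq_succ_of_family hSCH hι hε h2 hξ hf
      (fun α k x => pair (pair α.toZFSet k.toZFSet) x.toZFSet ∈ R.1)
      (fun α hα β hβ hne => by
        obtain ⟨i₀, hi₀, h⟩ := hED _ (toZFSet_mem_toZFSet_iff.2 hα) _
          (toZFSet_mem_toZFSet_iff.2 hβ) (toZFSet_injective.ne hne)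
        obtain ⟨i₀, hi₀', rfl⟩ := mem_toZFSet_iff.1 hi₀
        exact ⟨i₀, hi₀', fun k hk hik x => h _ (toZFSet_mem_toZFSet_iff.2 hk)
          (toZFSet_mem_toZFSet_iff.2 hik) _⟩)
      (fun y hy => by
        obtain ⟨α, hα, hyα, h⟩ := hmany _ (toZFSet_mem_toZFSet_iff.2 hy)
        obtain ⟨α, hα', rfl⟩ := mem_toZFSet_iff.1 hα
        refine ⟨α, hα', toZFSet_mem_toZFSet_iff.1 hyα, fun k hk => ?_⟩
        obtain ⟨x, hx, hxε, h⟩ := h _ (toZFSet_mem_toZFSet_iff.2 hk)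
        obtain ⟨x, hx', rfl⟩ := mem_toZFSet_iff.1 hxε
        exact ⟨x, by simpa [c] using (mem_sep.1 hx).2, hx', h⟩)
    exact (sat_cofIsSucc isPairingClass_univ 3 (i + 4) hσs hi).2 (cofIsSuccIn_univ hν hsing)

end ClubPrinciple

/-! ### Basic properties of the embedding and its critical point -/

/-- The valuation with the given values for the variables `0`, `1`, `2`. -/
def val₃ (x y z : ZFSet.{u}) : ℕ → ZFSet.{u} := cons x (cons y (cons z fun _ => ∅))

/-- The action of an elementary embedding on ordinals. -/
noncomputable def ordMap {M : Set ZFSet.{u}} (j : ZFSet.{u} ↪ₑ[memLang] M) (α : Ordinal.{u}) :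
    Ordinal.{u} :=
  (j α.toZFSet : ZFSet.{u}).rank

section Embedding

open ZFSet SetFormula

variable {M : Set ZFSet.{u}} (j : ZFSet.{u} ↪ₑ[memLang] M)

theorem map_mem_iff {x y : ZFSet.{u}} : (j x : ZFSet.{u}) ∈ (j y : ZFSet.{u}) ↔ x ∈ y :=
  sat_map j (val₃ x y ∅) (.mem 0 1)

theorem map_subset (hM : ∀ x ∈ M, ∀ y ∈ x, y ∈ M) {x y : ZFSet.{u}} (h : x ⊆ y) :
    (j x : ZFSet.{u}) ⊆ j y := fun z hz =>
  (sat_map j (val₃ x y ∅) (.all (.imp (.mem 0 1) (.mem 0 2)))).2 (fun _ hz => h hz)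
    ⟨z, hM _ (j x).2 _ hz⟩ hz

theorem ordMap_eq_self {κ α : Ordinal.{u}} (hκ : IsCriticalPoint j κ) (h : α < κ) : ordMap j α = α := by
  have : (j α.toZFSet : ZFSet.{u}) = α.toZFSet := not_not.1 fun h' => (hκ.2 h').not_gt h
  rw [ordMap, this, rank_toZFSet]

variable (hM : ∀ x ∈ M, ∀ y ∈ x, y ∈ M)
include j hM

theorem map_pair (x y : ZFSet.{u}) : (j (pair x y) : ZFSet.{u}) = pair (j x) (j y) := by
  have h := sat_map j (val₃ (pair x y) x y) (.isPair 0 1 2)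
  rw [sat_isPair (.of_embedding hM j), sat_isPair isPairingClass_univ] at h
  exact h.2 rfl

theorem map_toZFSet (α : Ordinal.{u}) : (j α.toZFSet : ZFSet.{u}) = (ordMap j α).toZFSet := by
  have h := sat_map j (val₃ α.toZFSet ∅ ∅) (.isOrdinal 0)
  rw [sat_isOrdinal (.of_embedding hM j), sat_isOrdinal isPairingClass_univ] at h
  exact (IsOrdinal.toZFSet_rank_eq (h.2 (isOrdinal_toZFSet α))).symm

theorem ordMap_strictMono : StrictMono (ordMap j) := fun α β h => by
  rw [← toZFSet_mem_toZFSet_iff, ← map_toZFSet j hM, ← map_toZFSet j hM, map_mem_iff]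
  exact toZFSet_mem_toZFSet_iff.2 h

theorem le_ordMap (α : Ordinal.{u}) : α ≤ ordMap j α := (ordMap_strictMono j hM).le_apply

/-- `M` contains `j(α) ≥ α` and is transitive. -/
theorem toZFSet_mem (α : Ordinal.{u}) : α.toZFSet ∈ M := by
  have h : (ordMap j α).toZFSet ∈ M := map_toZFSet j hM α ▸ (j α.toZFSet).2
  rcases (le_ordMap j hM α).eq_or_lt with h' | h'
  · rwa [← h'] at h
  · exact hM _ h _ (toZFSet_mem_toZFSet_iff.2 h')

/-- If `F` is functional, then so is its image. -/
theorem map_functional {F : ZFSet.{u}}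
    (hF : ∀ a b c, pair a b ∈ F → pair a c ∈ F → b = c) {a b c : ZFSet.{u}}
    (hb : pair a b ∈ (j F : ZFSet.{u})) (hc : pair a c ∈ (j F : ZFSet.{u})) : b = c := by
  have hN := IsPairingClass.of_embedding hM j
  have h := sat_map j (val₃ F ∅ ∅)
    (.all (.all (.all (.imp (pairMem 2 1 3) (.imp (pairMem 2 0 3) (.eq 1 0))))))
  simp only [Sat, sat_pairMem hN, sat_pairMem isPairingClass_univ, forall_univ_iff] at h
  have hp := hN.trans _ (j F).2 _ hb
  exact h.2 (fun a b c => hF a b c) ⟨a, hN.fst_mem hp⟩ ⟨b, hN.snd_mem hp⟩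
    ⟨c, hN.snd_mem (hN.trans _ (j F).2 _ hc)⟩ hb hc

/-- If `F` is injective, then so is its image. -/
theorem map_injective {F : ZFSet.{u}}
    (hF : ∀ a b c, pair a c ∈ F → pair b c ∈ F → a = b) {a b c : ZFSet.{u}}
    (ha : pair a c ∈ (j F : ZFSet.{u})) (hb : pair b c ∈ (j F : ZFSet.{u})) : a = b := by
  have hN := IsPairingClass.of_embedding hM j
  have h := sat_map j (val₃ F ∅ ∅)
    (.all (.all (.all (.imp (pairMem 2 0 3) (.imp (pairMem 1 0 3) (.eq 2 1))))))
  simp only [Sat, sat_pairMem hN, sat_pairMem isPairingClass_univ, forall_univ_iff] at h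
  have hp := hN.trans _ (j F).2 _ ha
  exact h.2 (fun a b c => hF a b c) ⟨a, hN.fst_mem hp⟩
    ⟨b, hN.fst_mem (hN.trans _ (j F).2 _ hb)⟩ ⟨c, hN.snd_mem hp⟩ ha hb

variable {κ : Ordinal.{u}} (hκ : IsCriticalPoint j κ)
include hκ

theorem map_toZFSet_eq_self {α : Ordinal.{u}} (h : α < κ) :
    (j α.toZFSet : ZFSet.{u}) = α.toZFSet := by
  rw [map_toZFSet j hM, ordMap_eq_self j hκ h]

theorem lt_ordMap_crit : κ < ordMap j κ := by
  refine (le_ordMap j hM κ).lt_of_ne fun h => hκ.1 ?_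
  rw [map_toZFSet j hM, ← h]

theorem map_eq_self_of_subset {γ : Ordinal.{u}} (hγ : γ < κ) {a : ZFSet.{u}}
    (ha : a ⊆ γ.toZFSet) : (j a : ZFSet.{u}) = a := by
  have h1 := map_subset j hM ha
  rw [map_toZFSet_eq_self j hM hκ hγ] at h1
  have h2 (x : ZFSet.{u}) (hx : x ∈ γ.toZFSet) : x ∈ (j a : ZFSet.{u}) ↔ x ∈ a := by
    obtain ⟨ξ, hξ, rfl⟩ := mem_toZFSet_iff.1 hx
    conv_lhs => rw [← map_toZFSet_eq_self j hM hκ (hξ.trans hγ)]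
    exact map_mem_iff j
  ext x
  exact ⟨fun hx => (h2 x (h1 hx)).1 hx, fun hx => (h2 x (ha hx)).2 hx⟩

-- Otherwise there is an injection `F : κ → 𝒫(γ)`. The value `a = j(F)(κ)` is a subset of `j(γ) =
-- γ`, so `j(a) = a`. Thus `M` sees `j(a)` in the range of `j(F)`, and by elementarity `a = F(b)`
-- for some `b < κ`. Then `j(F)(b) = a = j(F)(κ)`, contradicting injectivity of `j(F)`.
open Cardinal in
theorem two_power_lt_crit {γ : Ordinal.{u}} (hγ : γ < κ) : 2 ^ γ.card < κ.card := by
  by_contra! hle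
  have hN := IsPairingClass.of_embedding hM j
  have hP : #κ.toZFSet ≤ #γ.toZFSet.powerset := by
    rw [mk_toZFSet, cardinalMk_coe_sort, card_powerset, card_toZFSet]
    exact Cardinal.lift_le.2 hle
  obtain ⟨e⟩ := hP
  classical
  let F : ZFSet.{u} := funGraph κ.toZFSet fun a => if h : a ∈ κ.toZFSet then e ⟨a, h⟩ else ∅
  have hF {a b : ZFSet.{u}} : pair a b ∈ F ↔ ∃ h : a ∈ κ.toZFSet, b = e ⟨a, h⟩ := by
    rw [pair_mem_funGraph]
    constructor
    · rintro ⟨h, h'⟩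
      exact ⟨h, by rwa [dif_pos h] at h'⟩
    · rintro ⟨h, h'⟩
      exact ⟨h, by rwa [dif_pos h]⟩
  obtain ⟨a, haF, haγ⟩ : ∃ a, pair κ.toZFSet a ∈ (j F : ZFSet.{u}) ∧ a ⊆ γ.toZFSet := by
    have h := sat_map j (val₃ F κ.toZFSet γ.toZFSet) (.all (.imp (.mem 0 2) (.ex
      (.and (pairMem 1 0 2) (.all (.imp (.mem 0 1) (.mem 0 5)))))))
    simp only [Sat, sat_pairMem hN, sat_pairMem isPairingClass_univ, forall_univ_iff,
      exists_univ_iff] at h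
    obtain ⟨a, ha, ha'⟩ := h.2 (fun x hx => ⟨e ⟨x, hx⟩, hF.2 ⟨hx, rfl⟩, fun y hy =>
      mem_powerset.1 (e ⟨x, hx⟩).2 hy⟩) ⟨_, toZFSet_mem j hM κ⟩ (by
        change κ.toZFSet ∈ (j κ.toZFSet : ZFSet.{u})
        rw [map_toZFSet j hM]
        exact toZFSet_mem_toZFSet_iff.2 (lt_ordMap_crit j hM hκ))
    refine ⟨a, ha, fun y hy => ?_⟩
    rw [← map_toZFSet_eq_self j hM hκ hγ]
    exact ha' ⟨y, hN.trans _ a.2 _ hy⟩ hy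
  have haj := map_eq_self_of_subset j hM hκ hγ haγ
  obtain ⟨b, hbκ, hbF⟩ : ∃ b, b ∈ κ.toZFSet ∧ pair b a ∈ F := by
    have h := sat_map j (val₃ F κ.toZFSet a) (.ex (.and (.mem 0 2) (pairMem 0 3 1)))
    simp only [Sat, sat_pairMem hN, sat_pairMem isPairingClass_univ, exists_univ_iff] at h
    refine h.1 ⟨⟨_, toZFSet_mem j hM κ⟩, ?_, ?_⟩
    · change κ.toZFSet ∈ (j κ.toZFSet : ZFSet.{u})
      rw [map_toZFSet j hM]
      exact toZFSet_mem_toZFSet_iff.2 (lt_ordMap_crit j hM hκ)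
    · change pair κ.toZFSet (j a) ∈ (j F : ZFSet.{u})
      rwa [haj]
  obtain ⟨β, hβ, rfl⟩ := mem_toZFSet_iff.1 hbκ
  have hbF' := (map_mem_iff j).2 hbF
  rw [map_pair j hM, haj, map_toZFSet_eq_self j hM hκ hβ] at hbF'
  refine hβ.ne (toZFSet_injective (map_injective j hM ?_ hbF' haF))
  intro a b c h h'
  obtain ⟨h1, h2⟩ := hF.1 h
  obtain ⟨h1', h2'⟩ := hF.1 h'
  have := e.injective (Subtype.ext (h2.symm.trans h2'))
  exact congrArg Subtype.val this

/-- Continuity at countable suprema: the image under `j` of the sequence is still indexed by `j(ω) =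
ω`, and its `n`-th term is `j(a n)`. -/
theorem exists_lt_ordMap_of_iSup (hω : ω < κ) (a : ℕ → Ordinal.{u}) {y : Ordinal.{u}}
    (hy : y < ordMap j (⨆ n, a n)) : ∃ n, y < ordMap j (a n) := by
  have hN := IsPairingClass.of_embedding hM j
  let F : ZFSet.{u} := funGraph (ω : Ordinal.{u}).toZFSet fun x =>
    (a (Cardinal.toNat x.rank.card)).toZFSet
  have hF (n : ℕ) : pair (n : Ordinal.{u}).toZFSet (a n).toZFSet ∈ F := by
    rw [pair_mem_funGraph]
    exact ⟨toZFSet_mem_toZFSet_iff.2 (natCast_lt_omega0 n), by simp⟩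
  have h := sat_map j (val₃ F (ω : Ordinal.{u}).toZFSet (⨆ n, a n).toZFSet)
    (.all (.imp (.mem 0 3) (.ex (.and (.mem 0 3) (.ex (.and (pairMem 1 0 3) (.mem 2 0)))))))
  simp only [Sat, sat_pairMem hN, sat_pairMem isPairingClass_univ, forall_univ_iff,
    exists_univ_iff] at h
  obtain ⟨n, hn, x, hnx, hyx⟩ := h.2 (fun x hx => by
    obtain ⟨ξ, hξ, rfl⟩ := mem_toZFSet_iff.1 (show x ∈ (⨆ n, a n).toZFSet from hx)
    obtain ⟨n, hn⟩ := Ordinal.lt_iSup_iff.1 hξ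
    exact ⟨_, toZFSet_mem_toZFSet_iff.2 (natCast_lt_omega0 n), _, hF n,
      toZFSet_mem_toZFSet_iff.2 hn⟩) ⟨_, toZFSet_mem j hM y⟩ (by
    change y.toZFSet ∈ (j (⨆ n, a n).toZFSet : ZFSet.{u})
    rw [map_toZFSet j hM]
    exact toZFSet_mem_toZFSet_iff.2 hy)
  have hn : (n : ZFSet.{u}) ∈ (j (ω : Ordinal.{u}).toZFSet : ZFSet.{u}) := hn
  rw [map_toZFSet_eq_self j hM hκ hω] at hn
  obtain ⟨ξ, hξ, hn⟩ := mem_toZFSet_iff.1 hn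
  obtain ⟨m, rfl⟩ := lt_omega0.1 hξ
  have h1 := (map_mem_iff j).2 (hF m)
  rw [map_pair j hM, map_toZFSet_eq_self j hM hκ ((natCast_lt_omega0 m).trans hω), hn] at h1
  have h2 : (j (a m).toZFSet : ZFSet.{u}) = x := map_functional j hM (fun x y z h h' =>
    (pair_mem_funGraph.1 h).2.trans (pair_mem_funGraph.1 h').2.symm) h1 hnx
  have hyx : y.toZFSet ∈ (x : ZFSet.{u}) := hyx
  rw [← h2, map_toZFSet j hM] at hyx
  exact ⟨m, toZFSet_mem_toZFSet_iff.1 hyx⟩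

end Embedding

/-! ### The supremum of the image of `δ` -/

section SupImage

open ZFSet SetFormula Cardinal

variable {M : Set ZFSet.{u}} (j : ZFSet.{u} ↪ₑ[memLang] M)

theorem lt_supImage_iff {δ y : Ordinal.{u}} : y < supImage j δ ↔ ∃ α < δ, y < ordMap j α := by
  rw [supImage, Ordinal.lt_iSup_iff]
  exact ⟨fun ⟨α, h⟩ => ⟨α.1, α.2, h⟩, fun ⟨α, hα, h⟩ => ⟨⟨α, hα⟩, h⟩⟩

variable (hM : ∀ x ∈ M, ∀ y ∈ x, y ∈ M)
include j hM

theorem supImage_le (δ : Ordinal.{u}) : supImage j δ ≤ ordMap j δ :=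
  Ordinal.iSup_le fun α => (ordMap_strictMono j hM α.2).le

theorem ordMap_lt_supImage {δ α : Ordinal.{u}} (hδ : Order.IsSuccLimit δ) (hα : α < δ) :
    ordMap j α < supImage j δ :=
  (lt_supImage_iff j).2 ⟨_, hδ.succ_lt hα, ordMap_strictMono j hM (Order.lt_succ α)⟩

theorem isLimit_supImage {δ : Ordinal.{u}} (hδ : Order.IsSuccLimit δ) {v : ℕ → M} {s : ℕ}
    (hs : (v s : ZFSet.{u}) = (supImage j δ).toZFSet) : Sat v (.isLimit s) := by
  simp only [isLimit, Sat, sat_isOrdinal (.of_embedding hM j)]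
  change (v s : ZFSet.{u}).IsOrdinal ∧ (∃ x : M, x.1 ∈ (v s).1) ∧
    ∀ x : M, x.1 ∈ (v s).1 → ∃ y : M, y.1 ∈ (v s).1 ∧ x.1 ∈ y.1
  rw [hs]
  have hmem {α : Ordinal.{u}} (hα : α < δ) :
      (ordMap j α).toZFSet ∈ (supImage j δ).toZFSet :=
    toZFSet_mem_toZFSet_iff.2 (ordMap_lt_supImage j hM hδ hα)
  refine ⟨isOrdinal_toZFSet _, ⟨⟨_, toZFSet_mem j hM (ordMap j 0)⟩, hmem hδ.bot_lt⟩,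
    fun x hx => ?_⟩
  obtain ⟨ξ, hξ, hx⟩ := mem_toZFSet_iff.1 hx
  obtain ⟨α, hα, h⟩ := (lt_supImage_iff j).1 hξ
  exact ⟨⟨_, toZFSet_mem j hM (ordMap j α)⟩, hmem hα, hx ▸ toZFSet_mem_toZFSet_iff.2 h⟩

/-- The subsets of `ι` in `M` are among those in `V`. Each value of `H` below `σ` lies below some
`j(α)` with `α < δ`, and `2 ^ ι < cf δ` bounds all these `α` at once. -/
theorem powersetBounded_supImage {δ : Ordinal.{u}} (hδ : Order.IsSuccLimit δ) {ι : Cardinal.{u}}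
    (h2 : 2 ^ ι < δ.cof) {v : ℕ → M} {s i : ℕ}
    (hs : (v s : ZFSet.{u}) = (supImage j δ).toZFSet) (hi : (v i : ZFSet.{u}) = ι.ord.toZFSet) :
    Sat v (.powersetBounded s i) := by
  have hN := IsPairingClass.of_embedding hM j
  simp only [powersetBounded, Sat, sat_pairMem hN]
  intro H hH
  have hH : ∀ a y y' : M, pair a y ∈ H.1 → pair a y' ∈ H.1 → (y : ZFSet.{u}) = y' := hH
  change ∃ b : M, b.1 ∈ (v s).1 ∧ ∀ a : M, (∀ z : M, z.1 ∈ a.1 → z.1 ∈ (v i).1) →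
    ∀ y : M, y.1 ∈ (v s).1 → pair a y ∈ H.1 → y.1 ∈ b.1
  rw [hs, hi]
  -- `Shrink` brings the index type into universe `u`, so that the supremum of the chosen `α` can be
  -- compared with `δ.cof`.
  have key (t : Shrink.{u} ι.ord.toZFSet.powerset) : ∃ α < δ, ∀ y : Ordinal.{u},
      y < supImage j δ → pair ((equivShrink _).symm t).1 y.toZFSet ∈ H.1 → y < ordMap j α := by
    by_cases h : ∃ y : Ordinal.{u}, y < supImage j δ ∧
        pair ((equivShrink _).symm t).1 y.toZFSet ∈ H.1
    · obtain ⟨y, hy, hyH⟩ := h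
      obtain ⟨α, hα, hyα⟩ := (lt_supImage_iff j).1 hy
      refine ⟨α, hα, fun y' _ hy' => ?_⟩
      have := hH ⟨_, hN.fst_mem (hN.trans _ H.2 _ hyH)⟩ ⟨_, toZFSet_mem j hM y'⟩
        ⟨_, toZFSet_mem j hM y⟩ hy' hyH
      rwa [toZFSet_injective this]
    · exact ⟨0, hδ.bot_lt, fun y hy hyH => absurd ⟨y, hy, hyH⟩ h⟩
  choose f hf hf' using key
  have hcard : #(Shrink.{u} ι.ord.toZFSet.powerset) < δ.cof := by
    change ι.ord.toZFSet.powerset.card < _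
    rwa [card_powerset, card_toZFSet, card_ord]
  have hsup := iSup_lt_of_lt_cof hcard hf
  refine ⟨⟨_, toZFSet_mem j hM (ordMap j (⨆ t, f t))⟩,
    toZFSet_mem_toZFSet_iff.2 (ordMap_lt_supImage j hM hδ hsup), fun a ha y hy hyH => ?_⟩
  obtain ⟨ξ, hξ, hyξ⟩ := mem_toZFSet_iff.1 hy
  have haP : a.1 ∈ ι.ord.toZFSet.powerset :=
    mem_powerset.2 fun z hz => ha ⟨z, hN.trans _ a.2 _ hz⟩ hz
  have h1 := hf' (equivShrink _ ⟨a.1, haP⟩) ξ hξ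
  rw [Equiv.symm_apply_apply, hyξ] at h1
  rw [← hyξ]
  exact toZFSet_mem_toZFSet_iff.2 ((h1 hyH).trans_le
    ((ordMap_strictMono j hM).monotone (Ordinal.le_iSup f _)))

variable {κ : Ordinal.{u}} (hκ : IsCriticalPoint j κ)
include hκ

/-- Interleave `j(α₀) < z₀ < j(α₁) < z₁ < ⋯` with `zₙ ∈ C`. The supremum `β` of the `αₙ` is below
`δ`, and `j(β)` is the supremum of the `j(αₙ)`, hence a limit point of `C`. -/
theorem exists_mem_club (hω : ω < κ) {δ : Ordinal.{u}} (hδ : ℵ₀ < δ.cof) {C : ZFSet.{u}}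
    (hunb : ∀ y < supImage j δ, ∃ z < supImage j δ, y < z ∧ z.toZFSet ∈ C)
    (hcl : ∀ x < supImage j δ, (∀ y < x, ∃ z < x, y < z ∧ z.toZFSet ∈ C) → x.toZFSet ∈ C)
    {α : Ordinal.{u}} (hα : α < δ) :
    ∃ β < δ, α < β ∧ (ordMap j β).toZFSet ∈ C := by
  have hlim : Order.IsSuccLimit δ := one_lt_cof_iff.1 (one_lt_aleph0.trans hδ)
  have hstep (α : Set.Iio δ) : ∃ β : Set.Iio δ, ∃ z, ordMap j α.1 < z ∧ z < ordMap j β.1 ∧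
      z.toZFSet ∈ C := by
    obtain ⟨z, hz, hαz, hzC⟩ := hunb _ (ordMap_lt_supImage j hM hlim α.2)
    obtain ⟨β, hβ, h⟩ := (lt_supImage_iff j).1 hz
    exact ⟨⟨β, hβ⟩, z, hαz, h, hzC⟩
  choose f z hz hz' hzC using hstep
  let a : ℕ → Set.Iio δ := fun n => f^[n] ⟨α, hα⟩
  have ha (n : ℕ) : a (n + 1) = f (a n) := Function.iterate_succ_apply' f n _
  have hβ : (⨆ n, (a n).1) < δ := by
    refine lift_iSup_lt_of_lt_cof ?_ fun n => (a n).2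
    rw [mk_nat, lift_aleph0, Ordinal.lift_uzero]
    exact hδ
  have hle (n : ℕ) : (a n).1 ≤ ⨆ n, (a n).1 := Ordinal.le_iSup (fun n => (a n).1) n
  refine ⟨_, hβ, ?_, hcl _ (ordMap_lt_supImage j hM hlim hβ) fun y hy => ?_⟩
  · refine lt_of_lt_of_le ?_ (hle 1)
    rw [ha]
    exact (ordMap_strictMono j hM).lt_iff_lt.1 ((hz (a 0)).trans (hz' (a 0)))
  · obtain ⟨n, hn⟩ := exists_lt_ordMap_of_iSup j hM hκ hω (fun n => (a n).1) hy
    refine ⟨z (a n), (hz' (a n)).trans_le ?_, hn.trans (hz (a n)), hzC _⟩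
    rw [← ha]
    exact (ordMap_strictMono j hM).monotone (hle _)

theorem cofIsSuccIn_supImage (hSCH : SCH.{u}) (hω : ω < κ) {c : Cardinal.{u}} (hc : c.IsSingular)
    (hcκ : c.ord.cof.ord < κ) (h2 : 2 ^ c.ord.cof ≤ c) :
    CofIsSuccIn M (supImage j (Order.succ c).ord) c.ord.cof.ord := by
  have hN := IsPairingClass.of_embedding hM j
  have hreg : (Order.succ c).IsRegular := isRegular_succ hc.aleph0_le
  have hcof : (Order.succ c).ord.cof = Order.succ c := hreg.cof_ord
  set δ := (Order.succ c).ord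
  set ι := c.ord.cof
  have hlt : c < δ.cof := hcof ▸ Order.lt_succ c
  have hlim : Order.IsSuccLimit δ :=
    one_lt_cof_iff.1 (one_lt_aleph0.trans (hc.aleph0_le.trans_lt hlt))
  have hιreg : ι.IsRegular := by
    refine isRegular_cof (isSuccLimit_ord hc.aleph0_le)
  have hfix (k : Ordinal.{u}) (hk : k < ι.ord) : (j k.toZFSet : ZFSet.{u}) = k.toZFSet :=
    map_toZFSet_eq_self j hM hκ (hk.trans hcκ)
  -- The club principle in `M`.
  have hT := (sat_map j (val₃ ι.ord.toZFSet ∅ ∅) (clubPrinciple 0)).2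
    (sat_clubPrinciple_univ hSCH hιreg _ 0 rfl)
  simp only [clubPrinciple, Sat] at hT
  obtain ⟨C, hC, hT⟩ := hT ⟨_, toZFSet_mem j hM (supImage j δ)⟩
    (isLimit_supImage j hM hlim rfl)
  simp only [isClub, Sat] at hC
  obtain ⟨hunb, hcl⟩ := hC
  have hunb : ∀ y : M, y.1 ∈ (supImage j δ).toZFSet → ∃ z : M, z.1 ∈ C.1 ∧
    z.1 ∈ (supImage j δ).toZFSet ∧ y.1 ∈ z.1 := hunb
  have hcl : ∀ x : M, x.1 ∈ (supImage j δ).toZFSet → (∀ y : M, y.1 ∈ x.1 → ∃ z : M, z.1 ∈ C.1 ∧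
    y.1 ∈ z.1 ∧ z.1 ∈ x.1) → x.1 ∈ C.1 := hcl
  -- The preimage of the club is unbounded.
  have hE {α : Ordinal.{u}} (hα : α < δ) : ∃ β < δ, α < β ∧ (ordMap j β).toZFSet ∈ C.1 := by
    refine exists_mem_club j hM hκ hω (hc.aleph0_le.trans_lt hlt) (fun y hy => ?_)
      (fun x hx h => ?_) hα
    · obtain ⟨z, hz, hz', hyz⟩ := hunb ⟨_, toZFSet_mem j hM y⟩ (toZFSet_mem_toZFSet_iff.2 hy)
      obtain ⟨ζ, hζ, hζz⟩ := mem_toZFSet_iff.1 hz'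
      rw [← hζz] at hz hyz
      exact ⟨ζ, hζ, toZFSet_mem_toZFSet_iff.1 hyz, hz⟩
    · refine hcl ⟨_, toZFSet_mem j hM x⟩ (toZFSet_mem_toZFSet_iff.2 hx) fun y hy => ?_
      obtain ⟨η, hη, hηy⟩ := mem_toZFSet_iff.1 hy
      obtain ⟨z, hz, hηz, hzC⟩ := h η hη
      exact ⟨⟨_, toZFSet_mem j hM z⟩, hzC, hηy ▸ toZFSet_mem_toZFSet_iff.2 hηz,
        toZFSet_mem_toZFSet_iff.2 hz⟩
  -- A bounded part of the preimage of size `c`, and `δ` eventually different functions into it.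
  let val {o : Ordinal.{u}} (b : o.ToType) : Ordinal.{u} := (ToType.mk.symm b).1
  have hval {o : Ordinal.{u}} (b : o.ToType) : val b < o := (ToType.mk.symm b).2
  have hmk {o k : Ordinal.{u}} (h : k < o) : val (ToType.mk ⟨k, h⟩ : o.ToType) = k := by simp [val]
  have hinj {o : Ordinal.{u}} {b b' : o.ToType} (h : val b = val b') : b = b' :=
    ToType.mk.symm.injective (Subtype.ext h)
  let E : Set δ.ToType := {d | (ordMap j (val d)).toZFSet ∈ C.1}
  -- `E` is unbounded in `δ`, so it has at least `cf δ > c` elements.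
  have hEc : #c.ord.ToType ≤ #E := by
    rw [mk_toType, card_ord]
    refine hlt.le.trans ?_
    rw [← cof_toType]
    refine Order.cof_le fun b => ?_
    obtain ⟨β, hβ, hbβ, h⟩ := hE (hval b)
    refine ⟨ToType.mk ⟨β, hβ⟩, ?_, ?_⟩
    · simpa only [E, Set.mem_ofPred_eq, hmk] using h
    · rw [← ToType.mk.symm.le_iff_le, OrderIso.symm_apply_apply]
      exact hbβ.le
  obtain ⟨e⟩ := hEc
  let w (a : c.ord.ToType) : Ordinal.{u} := val (e a).1
  have hw : Function.Injective w := fun a b h => e.injective (Subtype.ext (hinj h))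
  -- A strict bound below `δ`, since only `c < cf δ` elements were selected.
  let ε : Ordinal.{u} := ⨆ a, w a + 1
  have hε : ε < δ := iSup_add_one_lt_of_lt_cof (by rwa [mk_toType, card_ord]) fun a => hval _
  have hwε (a : c.ord.ToType) : w a < ε :=
    (lt_add_one (w a)).trans_le (Ordinal.le_iSup (fun a => w a + 1) a)
  obtain ⟨g, hg⟩ := exists_eventually_different hc.aleph0_le
  let R : ZFSet.{u} := ZFSet.range fun p : δ.ToType × ι.ord.ToType =>
    pair (pair (val p.1).toZFSet (val p.2).toZFSet) (w (g p.1 p.2)).toZFSet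
  have hR {a k x : ZFSet.{u}} : pair (pair a k) x ∈ R ↔ ∃ d i, (val d).toZFSet = a ∧
      (val i).toZFSet = k ∧ (w (g d i)).toZFSet = x := by
    simp only [R, ZFSet.mem_range, pair_inj, Prod.exists, and_assoc]
    exact Iff.rfl
  have hED : Sat (fun n => up (val₃ R δ.toZFSet ι.ord.toZFSet n)) (eventuallyDifferent 0 1 2) := by
    rw [sat_eventuallyDifferent_univ]
    change ∀ α ∈ δ.toZFSet, ∀ β ∈ δ.toZFSet, α ≠ β → ∃ i₀ ∈ ι.ord.toZFSet, ∀ k ∈ ι.ord.toZFSet,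
      i₀ ∈ k → ∀ x, pair (pair α k) x ∈ R → pair (pair β k) x ∉ R
    intro α hα β hβ hne
    obtain ⟨α, hα', rfl⟩ := mem_toZFSet_iff.1 hα
    obtain ⟨β, hβ', rfl⟩ := mem_toZFSet_iff.1 hβ
    obtain ⟨i₀, hi₀⟩ := hg (ToType.mk ⟨α, hα'⟩) (ToType.mk ⟨β, hβ'⟩) fun h => hne <| by
      rw [← hmk hα', ← hmk hβ']
      exact congrArg (fun d => (val d).toZFSet) h
    refine ⟨(val i₀).toZFSet, toZFSet_mem_toZFSet_iff.2 (hval i₀), fun k _ hik x h h' => ?_⟩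
    obtain ⟨d, i, hd, hi, hx⟩ := hR.1 h
    obtain ⟨d', i', hd', hi', hx'⟩ := hR.1 h'
    have h1 : d = ToType.mk ⟨α, hα'⟩ := hinj (by rw [hmk, toZFSet_injective hd])
    have h2 : d' = ToType.mk ⟨β, hβ'⟩ := hinj (by rw [hmk, toZFSet_injective hd'])
    have h3 : i' = i := hinj (toZFSet_injective (hi'.trans hi.symm))
    subst h1 h2 h3
    refine hi₀ i' ?_ (hw (toZFSet_injective (hx.trans hx'.symm)))
    rw [← hi, toZFSet_mem_toZFSet_iff] at hik
    exact ToType.mk.symm.lt_iff_lt.1 hik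
  rw [← sat_map, sat_eventuallyDifferent hN] at hED
  have hED : ∀ α : M, α.1 ∈ (j δ.toZFSet).1 → ∀ β : M, β.1 ∈ (j δ.toZFSet).1 → α.1 ≠ β.1 →
    ∃ i₀ : M, i₀.1 ∈ (j ι.ord.toZFSet).1 ∧ ∀ k : M, k.1 ∈ (j ι.ord.toZFSet).1 → i₀.1 ∈ k.1 →
      ∀ x : M, pair (pair α k) x ∈ (j R).1 → pair (pair β k) x ∉ (j R).1 := hED
  -- `j(R)` is indexed by `j(δ)`, which may exceed `σ`; only the indices below `σ` matter.
  have hsub : (supImage j δ).toZFSet ⊆ (j δ.toZFSet).1 := by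
    rw [map_toZFSet j hM, toZFSet_subset_toZFSet_iff]
    exact supImage_le j hM δ
  have hιj := map_toZFSet_eq_self j hM hκ hcκ
  refine (sat_cofIsSucc hN 3 4 (by rfl) (by exact hιj)).1
    (hT (j ε.toZFSet) ?_ (j R) ?_ ?_ ?_)
  · change (j ε.toZFSet).1 ∈ (supImage j δ).toZFSet
    rw [map_toZFSet j hM]
    exact toZFSet_mem_toZFSet_iff.2 (ordMap_lt_supImage j hM hlim hε)
  · rw [sat_eventuallyDifferent hN]
    exact fun α hα β hβ => hED α (hsub hα) β (hsub hβ)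
  · simp only [manyValues, Sat, sat_tripleMem hN]
    change ∀ y : M, y.1 ∈ (supImage j δ).toZFSet → ∃ α : M, α.1 ∈ (supImage j δ).toZFSet ∧
      y.1 ∈ α.1 ∧ ∀ k : M, k.1 ∈ (j ι.ord.toZFSet).1 → ∃ x : M, x.1 ∈ C.1 ∧
        x.1 ∈ (j ε.toZFSet).1 ∧ pair (pair α k) x ∈ (j R).1
    intro y hy
    obtain ⟨η, hη, hηy⟩ := mem_toZFSet_iff.1 hy
    obtain ⟨α, hα, hηα⟩ := (lt_supImage_iff j).1 hη
    refine ⟨j α.toZFSet, ?_, ?_, fun k hk => ?_⟩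
    · rw [map_toZFSet j hM]
      exact toZFSet_mem_toZFSet_iff.2 (ordMap_lt_supImage j hM hlim hα)
    · rw [map_toZFSet j hM, ← hηy]
      exact toZFSet_mem_toZFSet_iff.2 hηα
    · rw [hιj] at hk
      obtain ⟨i, hi, hik⟩ := mem_toZFSet_iff.1 hk
      -- Since `j(i) = i`, the function coded by `j(R)` at `j(α)` sends `i` to `j(w a)`, which lies
      -- in `C` by the choice of `E`.
      let a := g (ToType.mk ⟨α, hα⟩) (ToType.mk ⟨i, hi⟩)
      refine ⟨j (w a).toZFSet, ?_, ?_, ?_⟩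
      · rw [map_toZFSet j hM]
        exact (e a).2
      · rw [map_mem_iff]
        exact toZFSet_mem_toZFSet_iff.2 (hwε a)
      · rw [← hik, ← hfix i hi, ← map_pair j hM, ← map_pair j hM, map_mem_iff]
        exact hR.2 ⟨_, _, by rw [hmk], by rw [hmk], rfl⟩
  · exact powersetBounded_supImage j hM hlim (h2.trans_lt hlt) (by rfl) (by exact hιj)

/-- Here `c⁺ ≤ 2 ^ c < |κ|`, so `δ` and every smaller ordinal are fixed and `σ = δ`; the assertion
is then transferred from `V`. SCH is not needed. -/
theorem cofIsSuccIn_supImage_of_lt {c : Cardinal.{u}} (hc : c.IsSingular)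
    (hcκ : c.ord.cof.ord < κ) (h : c.ord < κ) :
    CofIsSuccIn M (supImage j (Order.succ c).ord) c.ord.cof.ord := by
  have hN := IsPairingClass.of_embedding hM j
  have hreg : (Order.succ c).IsRegular := isRegular_succ hc.aleph0_le
  set δ := (Order.succ c).ord with hδ
  have hlim : Order.IsSuccLimit δ := isSuccLimit_ord hreg.aleph0_le
  have hδκ : δ < κ := by
    have := two_power_lt_crit j hM hκ h
    rw [card_ord] at this
    exact lt_ord_succ_card δ |>.trans_le (by
      rw [hδ, card_ord, ord_le]
      exact Order.succ_le_of_lt ((Order.succ_le_of_lt (cantor c)).trans_lt this))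
  have hsup : supImage j δ = δ := by
    refine le_antisymm ((supImage_le j hM δ).trans_eq (ordMap_eq_self j hκ hδκ)) ?_
    refine le_of_forall_lt fun y hy => ?_
    exact (le_ordMap j hM y).trans_lt (ordMap_lt_supImage j hM hlim hy)
  rw [hsup]
  have h1 : Sat (fun n => up (val₃ δ.toZFSet c.ord.cof.ord.toZFSet ∅ n)) (cofIsSucc 0 1) :=
    (sat_cofIsSucc isPairingClass_univ 0 1 (by rfl) (by rfl)).2 (cofIsSuccIn_univ hreg.cof_ord hc)
  rw [← sat_map] at h1
  exact (sat_cofIsSucc hN 0 1 (map_toZFSet_eq_self j hM hκ hδκ)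
    (map_toZFSet_eq_self j hM hκ hcκ)).1 h1

end SupImage

end SetEmb

theorem mainTheorem8 (hSCH : SetEmb.SCH.{u})
    (M : Set ZFSet.{u}) (hM : ∀ x ∈ M, ∀ y ∈ x, y ∈ M)
    (j : FirstOrder.Language.ElementaryEmbedding SetEmb.memLang ZFSet.{u} M)
    (κ : Ordinal.{u}) (hκ : SetEmb.IsCriticalPoint j κ)
    (lam ι : Cardinal.{u}) (hlam : lam.IsSingular) (hι : lam.ord.cof = ι) (hικ : ι.ord < κ)
    (δ : Ordinal.{u}) (hδ : δ = (Order.succ lam).ord) :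
    ∃ θ η : Ordinal.{u},
      SetEmb.IsCofIn M (SetEmb.supImage j δ) θ ∧
      SetEmb.IsSuccCardinalIn M η θ ∧
      SetEmb.IsSingularCardinalIn M η ∧
      SetEmb.IsCofIn M η ι.ord := by
  subst hι hδ
  have hω : Ordinal.omega0 ≤ lam.ord.cof.ord := by
    rw [← Cardinal.ord_aleph0, Cardinal.ord_le_ord]
    exact (Cardinal.isRegular_cof (Cardinal.isSuccLimit_ord hlam.aleph0_le)).aleph0_le
  have h : SetEmb.CofIsSuccIn M (SetEmb.supImage j (Order.succ lam).ord) lam.ord.cof.ord := by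
    -- If `κ ≤ λ`, then `2 ^ ι < |κ| ≤ λ`. This can fail when `λ < κ`, so that case is treated
    -- separately.
    rcases lt_or_ge lam.ord κ with h | h
    · exact SetEmb.cofIsSuccIn_supImage_of_lt j hM hκ hlam hικ h
    · refine SetEmb.cofIsSuccIn_supImage j hM hκ hSCH (hω.trans_lt hικ) hlam hικ ?_
      have h2 := SetEmb.two_power_lt_crit j hM hκ hικ
      rw [Cardinal.card_ord] at h2
      refine h2.le.trans ?_
      simpa using Ordinal.card_le_card h
  obtain ⟨θ, -, h1, η, -, h2, h3, h4, h5⟩ := h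
  exact ⟨θ, η, h1, h2, ⟨h3, hω.trans h4.le, _, h4, h5⟩, h5⟩
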